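/- **Theorem (posterior consistency under the weak topology).** *Setting.* Let $\Omega$ be either a finite set (discrete topology) with $\mu$ the counting measure, or a possibly unbounded Euclidean rectangle (a product of intervals) with $\mu$ Lebesgue measure. Let $\mathcal A^0=\{\Omega\},\mathcal A^1,\mathcal A^2,\dots$ be nested dyadic partitions of $\Omega$: $\mathcal A^k$ has $2^k$ cells (possibly empty), and every cell $A$ of $\mathcal A^k$ is the disjoint union of its left child $A_l$ and right child $A_r$ in $\mathcal A^{k+1}$. Assume that all these cells (the *nodes*) generate the Borel $\sigma$-algebra. Write $A_p$ for the parent of a node $A\ne\Omega$. Let $Q_0$ be a probability measure on $\Omega$ and put $\theta_0(A)=Q_0(A_l)/Q_0(A)$ (and $0$ if $Q_0(A)=0$). *Markov-APT prior.* Let $I\ge 1$. Let $(\gamma_i(\Omega))_{i\le I}$ be a probability vector and, for every node $A\neq\Omega$, let $(\gamma_{i,i'}(A))_{i,i'\le I}$ be a stochastic matrix. For every node $A$ let $F^1_{\nu(A)},\dots,F^I_{\nu(A)}$ be probability measures on $(0,\infty]$ in increasing stochastic order. Let the states $C(A)\in\{1,\dots,I\}$ form a Markov tree: $P(C(\Omega)=i)=\gamma_i(\Omega)$,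 and $P(C(A)=i'\mid C(A_p)=i)=\gamma_{i,i'}(A)$, independently over the nodes of a level given the states at the previous levels. Given all $C(A)$, let the precisions $\nu(A)\sim F^{C(A)}_{\nu(A)}$ be independent; given all $C(A),\nu(A)$, let $\theta(A)\sim\mathrm{Beta}\bigl(\theta_0(A)\nu(A),(1-\theta_0(A))\nu(A)\bigr)$ be independent, where this is the point mass at $\theta_0(A)$ if $\nu(A)=\infty$ or $\theta_0(A)\in\{0,1\}$. The Markov-APT distribution $\pi$ is the law of the random probability measure $Q$ on $\Omega$ with $Q(A_l)=\theta(A)\,Q(A)$ for all nodes $A$. It is *stochastically increasing* if $\gamma_{i,i'}(A)=0$ whenever $i>i'$. *Assumptions.* Let $\pi$ be a stochastically increasing Markov-APT distribution such that 1. $F^I_{\nu(A)}$ is the point mass at $\infty$ for every node $A$, and there is $\delta>0$ such that for all large enough $k$, all $A\in\mathcal A^k$ and all $i<I$: $\gamma_{i,I}(A)>\delta$; 2. $Q_0\ll\mu$ and $I\ge2$; 3. there is $\delta'>0$ such that for all large enough $k$, all $A\in\mathcal A^k$ and all $i<I$: $\gamma_{i,I}(A)<1-\delta'$; 4. there are $\epsilon>0$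 and $0<N<\infty$ such that $F^i_{\nu(A)}((0,N])>\epsilon$ for all $i<I$ and all nodes $A$; 5. for every $k$, with positive probability no node of level at most $k$ is in state $I$ (for instance, this holds if $\gamma_I(\Omega)<1$ and $\gamma_{i,I}(A)<1$ for all $i<I$ and all $A\ne\Omega$). *Conclusion.* For each $n$ let $\pi(\cdot\mid X_1,\dots,X_n)$ be any version of the posterior, that is, any regular conditional distribution of $Q$ given $X_1,\dots,X_n$ when $Q\sim\pi$ and, given $Q$, the observations $X_1,\dots,X_n$ are i.i.d. from $Q$. Let $P_0\ll Q_0$ be a probability measure with ($Q_0$-essentially) bounded density $dP_0/dQ_0$. Then, with $P_0^{\infty}$-probability $1$, $$\pi(U\mid X_1,\dots,X_n)\longrightarrow 1\qquad(n\to\infty)$$ for every weak neighborhood $$U=\Bigl\{Q:\ \Bigl|\int f_i\,dQ-\int f_i\,dP_0\Bigr|<\epsilon_i,\ i=1,\dots,K\Bigr\}$$ of $P_0$, where $K\ge 0$, the $f_i$ are bounded continuous functions on $\Omega$ and $\epsilon_i>0$. -/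

import Mathlib

open MeasureTheory ProbabilityTheory Filter Topology
open scoped ENNReal NNReal BoundedContinuousFunction

namespace MarkovAPT

/-- `IsSampleSpace Ω μ`: either `Ω` is finite (with the discrete topology) and `μ` is the counting
measure, or `Ω` is (identified with) a possibly unbounded Euclidean rectangle `∏ i, J i ⊆ ℝ^p`, each
`J i` an interval of any kind, and `μ` is Lebesgue measure. -/
inductive IsSampleSpace (Ω : Type*) [TopologicalSpace Ω] [MeasurableSpace Ω] (μ : Measure Ω) : Prop
  | finite (hfin : Finite Ω) (hdisc : DiscreteTopology Ω) (hμ : μ = Measure.count)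
  | rectangle (p : ℕ) (J : Fin p → Set ℝ) (hJ : ∀ i, (J i).OrdConnected)
      (e : Ω ≃ₜ Set.pi Set.univ J)
      (hμ : μ.map (fun ω => (e ω : Fin p → ℝ)) = volume.restrict (Set.pi Set.univ J))

/-- A sequence of nested dyadic partitions of `Ω` that generates the σ-algebra.
A node of level `k` is a word `s : List Bool` of length `k`; the root is `[]`, the left and right
children of `s` are `false :: s` and `true :: s`, and the parent of `b :: s` is `s`. -/
structure PartitionTree (Ω : Type*) [mΩ : MeasurableSpace Ω] where
  cell : List Bool → Set Ω
  cell_root : cell [] = Set.univ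
  cell_union : ∀ s, cell s = cell (false :: s) ∪ cell (true :: s)
  cell_disjoint : ∀ s, Disjoint (cell (false :: s)) (cell (true :: s))
  generates : mΩ = MeasurableSpace.generateFrom (Set.range cell)

/-- Hyperparameters of a Markov adaptive Pólya tree with `I = m + 1` shrinkage states. The states
`1, …, I` are the elements of `Fin (m + 1)`, so that state `I` is `Fin.last m`. -/
structure Params (Ω : Type*) [MeasurableSpace Ω] (m : ℕ) where
  tree : PartitionTree Ω
  /-- the initial state probabilities at the root -/
  init : PMF (Fin (m + 1))
  /-- `trans s i j` is the probability that a node `s ≠ []` is in state `j` when its parent is in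
  state `i` (the value at the root is not used) -/
  trans : List Bool → Fin (m + 1) → PMF (Fin (m + 1))
  /-- `F s i` is the distribution of the precision of `s` in state `i`, a law on `(0, ∞]` -/
  F : List Bool → Fin (m + 1) → Measure ℝ≥0∞
  F_prob : ∀ s i, IsProbabilityMeasure (F s i)
  F_zero : ∀ s i, F s i {0} = 0
  /-- the components are in increasing stochastic order -/
  F_mono : ∀ s i j, i < j → ∀ t, F s i (Set.Ioi t) ≤ F s j (Set.Ioi t)
  Q₀ : ProbabilityMeasure Ω

/-- The Beta distribution with mean `t ∈ [0, 1]` and precision `v ∈ (0, ∞]`, i.e.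
`Beta (t v, (1 - t) v)`; it is the point mass at `t` if `v = ∞` or `t ∈ {0, 1}`. -/
noncomputable def betaMeanPrec (t : ℝ) (v : ℝ≥0∞) : Measure ℝ :=
  open Classical in
  if v = ∞ ∨ t ≤ 0 ∨ 1 ≤ t then Measure.dirac t
  else betaMeasure (t * v.toReal) ((1 - t) * v.toReal)

/-- The nodes of level at most `n`. -/
noncomputable def nodesUpTo (n : ℕ) : Finset (List Bool) :=
  (List.finite_length_le Bool n).toFinset

namespace Params

variable {Ω : Type*} [MeasurableSpace Ω] {m : ℕ} (P : Params Ω m)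

/-- The probability assignment coefficient `Q₀(A_l) / Q₀(A)` of `Q₀` (`0` if `Q₀(A) = 0`). -/
noncomputable def θ₀ (s : List Bool) : ℝ :=
  (P.Q₀ : Measure Ω).real (P.tree.cell (false :: s)) / (P.Q₀ : Measure Ω).real (P.tree.cell s)

/-- The probability that a node takes its state in the configuration `c`, given that its parent
(if any) does. -/
noncomputable def stateProb (c : List Bool → Fin (m + 1)) : List Bool → ℝ≥0∞
  | [] => P.init (c [])
  | b :: s => P.trans (b :: s) (c s) (c (b :: s))

end Params

/-- The hierarchical model: `C` is the Markov tree with the given initial and transition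
probabilities; given `C`, the `ν s` are independent with `ν s ∼ F s (C s)`; given `C` and `ν`, the
`θ s` are independent with `θ s ∼ Beta (θ₀ s * ν s, (1 - θ₀ s) * ν s)`. The joint law is expressed
by the product formula for the nodes of level at most `n`, for every `n`. -/
structure IsHierarchicalModel {Ω : Type*} [MeasurableSpace Ω] {m : ℕ} (P : Params Ω m)
    {S : Type*} [MeasurableSpace S] (Pr : Measure S)
    (C : List Bool → S → Fin (m + 1)) (ν : List Bool → S → ℝ≥0∞) (θ : List Bool → S → ℝ) :
    Prop where
  measurable_state : ∀ s, Measurable (C s)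
  measurable_prec : ∀ s, Measurable (ν s)
  measurable_pac : ∀ s, Measurable (θ s)
  law : ∀ (n : ℕ) (c : List Bool → Fin (m + 1)) (V : List Bool → Set ℝ≥0∞)
    (T : List Bool → Set ℝ), (∀ s, MeasurableSet (V s)) → (∀ s, MeasurableSet (T s)) →
    Pr {ω | ∀ s ∈ nodesUpTo n, C s ω = c s ∧ ν s ω ∈ V s ∧ θ s ω ∈ T s} =
      ∏ s ∈ nodesUpTo n,
        (P.stateProb c s * ∫⁻ v in V s, betaMeanPrec (P.θ₀ s) v (T s) ∂(P.F s (c s)))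

/-- `π` is the Markov-APT distribution with parameters `P`: the law of a random probability measure
`Q` whose probability assignment coefficients `θ s` (so `Q(A_l) = θ(A) Q(A)` for every node `A`)
are generated from the hierarchical model. -/
def IsMarkovAPT.{u} {Ω : Type u} [MeasurableSpace Ω] {m : ℕ} (P : Params Ω m)
    (π : Measure (ProbabilityMeasure Ω)) : Prop :=
  ∃ (S : Type u) (_ : MeasurableSpace S) (Pr : Measure S) (C : List Bool → S → Fin (m + 1))
    (ν : List Bool → S → ℝ≥0∞) (θ : List Bool → S → ℝ) (Q : S → ProbabilityMeasure Ω),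
    IsProbabilityMeasure Pr ∧ IsHierarchicalModel P Pr C ν θ ∧ Measurable Q ∧
    (∀ᵐ ω ∂Pr, ∀ s, (Q ω : Measure Ω).real (P.tree.cell (false :: s)) =
      θ s ω * (Q ω : Measure Ω).real (P.tree.cell s)) ∧
    π = Pr.map Q

namespace Params

variable {Ω : Type*} [MeasurableSpace Ω] {m : ℕ} (P : Params Ω m)

/-- All transition matrices are upper triangular. -/
def StochasticallyIncreasing : Prop :=
  ∀ (b : Bool) (s : List Bool) (i j : Fin (m + 1)), j < i → P.trans (b :: s) i j = 0

/-- State `I` is the complete shrinkage state, and at all large levels the transition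
probabilities into it are bounded away from `0`. -/
def AbsContCondition : Prop :=
  (∀ s, P.F s (Fin.last m) = Measure.dirac ∞) ∧
  ∃ δ : ℝ≥0∞, 0 < δ ∧ ∃ k₀ : ℕ, ∀ s, k₀ ≤ s.length → ∀ i, i ≠ Fin.last m →
    δ < P.trans s i (Fin.last m)

/-- The conditions of the large-support theorem that are added to absolute continuity. -/
structure LargeSupportCondition (μ : Measure Ω) : Prop where
  base_ac : (P.Q₀ : Measure Ω) ≪ μ
  two_le_states : 2 ≤ m + 1
  trans_lt : ∃ δ' : ℝ≥0∞, 0 < δ' ∧ ∃ k₀ : ℕ, ∀ s, k₀ ≤ s.length → ∀ i, i ≠ Fin.last m →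
    P.trans s i (Fin.last m) < 1 - δ'
  prec_mass : ∃ ε : ℝ≥0∞, 0 < ε ∧ ∃ N : ℝ≥0, 0 < N ∧ ∀ s i, i ≠ Fin.last m →
    ε < P.F s i (Set.Ioc 0 (N : ℝ≥0∞))

/-- For every `n`, with positive probability no node of level at most `n` is in the complete
shrinkage state. -/
def ShrinkageAvoidable : Prop :=
  ∀ n : ℕ, ∃ c : List Bool → Fin (m + 1), ∀ s, s.length ≤ n →
    c s ≠ Fin.last m ∧ 0 < P.stateProb c s

end Params

/-- The kernel `Q ↦ Q^n`: the law of `n` i.i.d. observations from `Q`. -/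
noncomputable def sampling (Ω : Type*) [MeasurableSpace Ω] (n : ℕ) :
    Kernel (ProbabilityMeasure Ω) (Fin n → Ω) where
  toFun Q := Measure.pi fun _ => (Q : Measure Ω)
  measurable' := by
    refine Measurable.measure_of_isPiSystem_of_isProbabilityMeasure
      generateFrom_pi.symm isPiSystem_pi ?_
    rintro _ ⟨t, ht, rfl⟩
    simp only [Measure.pi_pi]
    refine Finset.measurable_prod _ fun i _ => ?_
    exact (Measure.measurable_coe (ht i (Set.mem_univ i))).comp measurable_subtype_coe

/-- `post` is (a version of) the posterior of `Q` given `n` i.i.d. observations from `Q`, for the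
prior `π` on `Q`: a regular conditional distribution of `Q` given the observations. -/
structure IsPosterior {Ω : Type*} [MeasurableSpace Ω] (π : Measure (ProbabilityMeasure Ω)) {n : ℕ}
    (post : Kernel (Fin n → Ω) (ProbabilityMeasure Ω)) : Prop where
  markov : IsMarkovKernel post
  disintegrate : (sampling Ω n ∘ₘ π) ⊗ₘ post = (π ⊗ₘ sampling Ω n).map Prod.swap

/-- The weak neighborhood of `P₀` given by bounded continuous `f i` and radii `ε i`. -/
def weakNhd {Ω : Type*} [TopologicalSpace Ω] [MeasurableSpace Ω] (P₀ : ProbabilityMeasure Ω)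
    {K : ℕ} (f : Fin K → Ω →ᵇ ℝ) (ε : Fin K → ℝ) : Set (ProbabilityMeasure Ω) :=
  {Q | ∀ i, |∫ x, f i x ∂(Q : Measure Ω) - ∫ x, f i x ∂(P₀ : Measure Ω)| < ε i}

end MarkovAPT

namespace MarkovAPT

/-! ### Product measures, the law of large numbers and Hoeffding's bound. -/

section Product

variable {Ω : Type*} [MeasurableSpace Ω]

/-! The argument is Schwartz's theorem combined with a proof that the prior has Kullback–Leibler
support.

Schwartz part. Suppose that with prior probability `p > 0` the random `Q` dominates `e^{-U} P₀`,
where `U ≥ 0` has small `P₀`-mean. Then the marginal law of the data is at least `p` times the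
`n`-fold product of `e^{-U} P₀`. By the law of large numbers this costs only a factor `e^{nc}`, `c`
small, compared with `P₀^n`. Under the marginal law, exchanging data and parameter turns the
posterior mass of a half space `{∫ f dQ ≥ ∫ f dP₀ + ε}` into sampling probabilities that Hoeffding's
inequality makes exponentially small (`lintegral_posterior_le`). Summing over `n` gives almost sure
convergence for one half space. Separability and metrizability of `Ω` make the weak neighborhood
filter countably generated, so one null set serves all neighborhoods
(`posterior_consistent_of_klSupport`).

Support part. Complete shrinkage is absorbing. Hence with positive probability every node of level
at least `k` is in state `I`, so that `Q` is proportional to `Q₀` on each level-`k` cell, while the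
finitely many earlier coefficients fall in prescribed intervals
(`IsHierarchicalModel.measure_ne_zero`). Thus `Q` can dominate `r^k E[g | level k] Q₀` for any `r <
1` and any density `g` bounded away from zero (`IsMarkovAPT.measure_ne_zero`). Taking for `g` a
mixture of `dP₀/dQ₀` and `1`, `L¹` martingale convergence and the bound on `dP₀/dQ₀` show that the
loss relative to `P₀` has small `P₀`-mean (`IsMarkovAPT.klSupport`). -/

theorem lintegral_pi_prod (P : Measure Ω) [IsProbabilityMeasure P] (n : ℕ)
    {f : Fin n → Ω → ℝ≥0∞} (hf : ∀ i, Measurable (f i)) :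
    ∫⁻ x, ∏ i, f i (x i) ∂(Measure.pi fun _ : Fin n => P) = ∏ i, ∫⁻ y, f i y ∂P := by
  have hind := iIndepFun_pi (μ := fun _ : Fin n => P) (X := f) fun i => (hf i).aemeasurable
  rw [lintegral_prod_eq_prod_lintegral_of_indepFun Finset.univ
    (fun i (x : Fin n → Ω) => f i (x i)) hind fun i => (hf i).comp (measurable_pi_apply i)]
  refine Finset.prod_congr rfl fun i _ => ?_
  exact (measurePreserving_eval (fun _ : Fin n => P) i).lintegral_comp (hf i)

theorem pi_withDensity (P : Measure Ω) [IsProbabilityMeasure P] (n : ℕ) {f : Ω → ℝ≥0∞}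
    (hf : Measurable f) [SigmaFinite (P.withDensity f)] :
    Measure.pi (fun _ : Fin n => P.withDensity f) =
      (Measure.pi fun _ : Fin n => P).withDensity fun x => ∏ i, f (x i) := by
  refine Measure.pi_eq fun s hs => ?_
  rw [withDensity_apply _ (MeasurableSet.univ_pi hs), ← lintegral_indicator (MeasurableSet.univ_pi hs)]
  have : (Set.univ.pi s).indicator (fun x : Fin n → Ω => ∏ i, f (x i)) =
      fun x => ∏ i, (s i).indicator f (x i) := by
    ext x
    by_cases hx : x ∈ Set.univ.pi s
    · rw [Set.indicator_of_mem hx]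
      exact Finset.prod_congr rfl fun i _ => (Set.indicator_of_mem (hx i trivial) _).symm
    · rw [Set.indicator_of_notMem hx]
      simp only [Set.mem_univ_pi, not_forall] at hx
      obtain ⟨i, hi⟩ := hx
      exact (Finset.prod_eq_zero (Finset.mem_univ i) (Set.indicator_of_notMem hi _)).symm
  rw [this, lintegral_pi_prod P n fun i => hf.indicator (hs i)]
  refine Finset.prod_congr rfl fun i _ => ?_
  rw [lintegral_indicator (hs i), withDensity_apply _ (hs i)]

/-- The density of `ν` with respect to `Q` is at most `1`, hence so is the product density. -/
theorem pi_le_pi {ν Q : Measure Ω} [IsFiniteMeasure ν] [IsProbabilityMeasure Q] (h : ν ≤ Q)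
    (n : ℕ) : Measure.pi (fun _ : Fin n => ν) ≤ Measure.pi fun _ : Fin n => Q := by
  have hν : Q.withDensity (ν.rnDeriv Q) = ν :=
    Measure.withDensity_rnDeriv_eq ν Q (Measure.absolutelyContinuous_of_le h)
  have : IsFiniteMeasure (Q.withDensity (ν.rnDeriv Q)) := by rw [hν]; infer_instance
  have hpi := pi_withDensity Q n (Measure.measurable_rnDeriv ν Q)
  rw [hν] at hpi
  rw [hpi]
  conv_rhs => rw [← withDensity_one (μ := Measure.pi fun _ : Fin n => Q)]
  refine withDensity_mono ?_
  have h1 : ∀ i : Fin n, ∀ᵐ x ∂(Measure.pi fun _ : Fin n => Q), ν.rnDeriv Q (x i) ≤ 1 := fun i =>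
    (measurePreserving_eval (fun _ : Fin n => Q) i).quasiMeasurePreserving.ae
      (Measure.rnDeriv_le_one_of_le h)
  filter_upwards [ae_all_iff.2 h1] with x hx
  exact Finset.prod_le_one' fun i _ => hx i

theorem infinitePi_map_fin (P : Measure Ω) [IsProbabilityMeasure P] (n : ℕ) :
    (Measure.infinitePi fun _ : ℕ => P).map (fun x (i : Fin n) => x i) =
      Measure.pi fun _ : Fin n => P := by
  rw [Measure.map_infinitePi_infinitePi_of_inj (P := fun _ : ℕ => P) Fin.val_injective,
    Measure.infinitePi_eq_pi]

theorem strong_law_infinitePi (P : Measure Ω) [IsProbabilityMeasure P] {f : Ω → ℝ}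
    (hf : Measurable f) (hint : Integrable f P) :
    ∀ᵐ x ∂(Measure.infinitePi fun _ : ℕ => P),
      Tendsto (fun n : ℕ => (∑ i : Fin n, f (x i)) / n) atTop (𝓝 (∫ y, f y ∂P)) := by
  have hmp := fun i : ℕ => measurePreserving_eval_infinitePi (fun _ : ℕ => P) i
  have hind := iIndepFun_infinitePi (P := fun _ : ℕ => P) (X := fun _ => f) fun _ => hf
  have key := strong_law_ae_real (μ := Measure.infinitePi fun _ : ℕ => P)
    (fun i x => f (x i)) ((hmp 0).integrable_comp_of_integrable hint)
    (fun i j hij => hind.indepFun hij) fun i =>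
      ⟨(hf.comp (measurable_pi_apply i)).aemeasurable, (hf.comp (measurable_pi_apply 0)).aemeasurable,
        by
          have hi : ∀ j : ℕ, (Measure.infinitePi fun _ : ℕ => P).map (fun x => f (x j)) = P.map f :=
            fun j => by
              conv_rhs => rw [← (hmp j).map_eq, Measure.map_map hf (hmp j).measurable]
              rfl
          rw [hi i, hi 0]⟩
  have h0 : ∫ x, f (x 0) ∂(Measure.infinitePi fun _ : ℕ => P) = ∫ y, f y ∂P := by
    conv_rhs =>
      rw [← (hmp 0).map_eq, integral_map (hmp 0).measurable.aemeasurable hf.aestronglyMeasurable]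
  rw [h0] at key
  filter_upwards [key] with x hx
  refine hx.congr fun n => ?_
  rw [Fin.sum_univ_eq_sum_range fun i => f (x i)]

/-- Hoeffding's bound for the lower tail of the empirical mean. -/
theorem pi_sum_le_le_exp (Q : Measure Ω) [IsProbabilityMeasure Q] {f : Ω → ℝ} (hf : Measurable f)
    {b : ℝ} (hb : 0 < b) (hfb : ∀ x, |f x| ≤ b) {a ε : ℝ} (hε : 0 < ε)
    (ha : a + ε ≤ ∫ x, f x ∂Q) (n : ℕ) :
    Measure.pi (fun _ : Fin n => Q) {x | ∑ i, f (x i) ≤ n * a} ≤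
      ENNReal.ofReal (Real.exp (-(n * (ε ^ 2 / (2 * b ^ 2))))) := by
  rcases n.eq_zero_or_pos with rfl | hn
  · simp
  have hQ : HasSubgaussianMGF (fun ω => -f ω - ∫ x, -f x ∂Q) ((‖b - -b‖₊ / 2) ^ 2) Q :=
    hasSubgaussianMGF_of_mem_Icc hf.neg.aemeasurable
      (ae_of_all _ fun x => ⟨neg_le_neg (abs_le.1 (hfb x)).2, by linarith [(abs_le.1 (hfb x)).1]⟩)
  have hm : Measurable (fun ω => -f ω - ∫ x, -f x ∂Q) := hf.neg.sub_const _
  have hmp := fun i : Fin n => measurePreserving_eval (fun _ : Fin n => Q) i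
  have hind := iIndepFun_pi (μ := fun _ : Fin n => Q) (X := fun _ ω => -f ω - ∫ x, -f x ∂Q)
    fun _ => hm.aemeasurable
  have hsub : ∀ i ∈ (Finset.univ : Finset (Fin n)),
      HasSubgaussianMGF (fun x : Fin n → Ω => -f (x i) - ∫ x, -f x ∂Q) ((‖b - -b‖₊ / 2) ^ 2)
        (Measure.pi fun _ : Fin n => Q) := fun i _ => by
    refine HasSubgaussianMGF.of_map (X := fun ω => -f ω - ∫ x, -f x ∂Q)
      (Y := fun x : Fin n → Ω => x i) (hmp i).measurable.aemeasurable ?_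
    rw [(hmp i).map_eq]
    exact hQ
  have key := HasSubgaussianMGF.measure_sum_ge_le_of_iIndepFun hind hsub
    (mul_nonneg n.cast_nonneg hε.le : (0 : ℝ) ≤ n * ε)
  rw [← ofReal_measureReal]
  refine ENNReal.ofReal_le_ofReal ((measureReal_mono ?_).trans (key.trans (le_of_eq ?_)))
  · intro x hx
    simp only [Set.mem_ofPred_eq] at hx ⊢
    rw [integral_neg, Finset.sum_sub_distrib, Finset.sum_neg_distrib]
    simp only [Finset.sum_const, Finset.card_univ, Fintype.card_fin, nsmul_eq_mul]
    nlinarith [mul_le_mul_of_nonneg_left ha (Nat.cast_nonneg (α := ℝ) n)]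
  · congr 1
    simp only [Finset.sum_const, Finset.card_univ, Fintype.card_fin, nsmul_eq_mul]
    have hbb : (((‖b - -b‖₊ / 2) ^ 2 : ℝ≥0) : ℝ) = b ^ 2 := by
      have h2 : |b - -b| = 2 * b := by rw [abs_of_pos (by linarith)]; ring
      push_cast
      rw [Real.norm_eq_abs, h2]; ring
    push_cast at hbb ⊢
    rw [hbb]
    have : (n : ℝ) ≠ 0 := by positivity
    field_simp

end Product

/-! ### Schwartz's argument for a single half space. -/

section Schwartz

variable {Ω : Type*} [MeasurableSpace Ω]

/-- Every Kullback–Leibler type neighborhood of `P₀` has positive prior probability: for every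
`c > 0`, with positive probability `Q ≥ e^{-U} P₀` for some `U ≥ 0` with `∫ U dP₀ < c`. -/
def KLSupport (π : Measure (ProbabilityMeasure Ω)) (P₀ : Measure Ω) : Prop :=
  ∀ c : ℝ, 0 < c → ∃ U : Ω → ℝ, Measurable U ∧ (∀ x, 0 ≤ U x) ∧ Integrable U P₀ ∧
    ∫ x, U x ∂P₀ < c ∧
    π {Q | P₀.withDensity (fun x => ENNReal.ofReal (Real.exp (-U x))) ≤ (Q : Measure Ω)} ≠ 0

theorem measurable_integral_coe {f : Ω → ℝ} (hf : Measurable f) :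
    Measurable fun Q : ProbabilityMeasure Ω => ∫ x, f x ∂(Q : Measure Ω) :=
  (StronglyMeasurable.integral_kernel
    (κ := (⟨fun Q => (Q : Measure Ω), measurable_subtype_coe⟩ : Kernel (ProbabilityMeasure Ω) Ω))
    hf.stronglyMeasurable).measurable

instance (n : ℕ) : IsMarkovKernel (sampling Ω n) :=
  ⟨fun Q => by
    change IsProbabilityMeasure (Measure.pi fun _ : Fin n => (Q : Measure Ω))
    infer_instance⟩

/-- This replaces the usual lower bound on the integrated likelihood ratio: only the `Q` above `ν`
are kept in the mixture. -/
theorem smul_pi_le_marginal (π : Measure (ProbabilityMeasure Ω)) (ν : Measure Ω)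
    [IsFiniteMeasure ν] (n : ℕ) :
    π {Q | ν ≤ (Q : Measure Ω)} • Measure.pi (fun _ : Fin n => ν) ≤ sampling Ω n ∘ₘ π := by
  refine Measure.le_iff.2 fun D hD => ?_
  rw [Measure.bind_apply hD (sampling Ω n).measurable.aemeasurable, Measure.smul_apply, smul_eq_mul,
    mul_comm]
  -- Markov's inequality for `Q ↦ Q^n(D)`; its superlevel set contains `{Q | ν ≤ Q}`, which need not
  -- be known to be measurable.
  refine le_trans ?_ (mul_meas_ge_le_lintegral ((sampling Ω n).measurable_coe hD)
    (Measure.pi (fun _ : Fin n => ν) D))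
  gcongr
  intro hQ
  exact pi_le_pi hQ n D

theorem IsPosterior.lintegral_eq {π : Measure (ProbabilityMeasure Ω)} [IsProbabilityMeasure π]
    {n : ℕ} {post : Kernel (Fin n → Ω) (ProbabilityMeasure Ω)} (h : IsPosterior π post)
    {D : Set (Fin n → Ω)} (hD : MeasurableSet D) {B : Set (ProbabilityMeasure Ω)}
    (hB : MeasurableSet B) :
    ∫⁻ x in D, post x B ∂(sampling Ω n ∘ₘ π) = ∫⁻ Q in B, sampling Ω n Q D ∂π := by
  have := h.markov
  rw [← Measure.compProd_apply_prod hD hB, h.disintegrate,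
    Measure.map_apply measurable_swap (hD.prod hB), Set.preimage_swap_prod,
    Measure.compProd_apply_prod hB hD]

/-- The posterior probability of a half space that excludes `P₀` decays exponentially in
`P₀`-mean, on the events that the empirical means of `f` and of `U` are small. -/
theorem lintegral_posterior_le {π : Measure (ProbabilityMeasure Ω)} [IsProbabilityMeasure π]
    {n : ℕ} {post : Kernel (Fin n → Ω) (ProbabilityMeasure Ω)} (h : IsPosterior π post)
    (P₀ : Measure Ω) [IsProbabilityMeasure P₀] {U : Ω → ℝ} (hU : Measurable U)
    (hU0 : ∀ x, 0 ≤ U x) {f : Ω → ℝ} (hf : Measurable f) {b : ℝ} (hb : 0 < b)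
    (hfb : ∀ x, |f x| ≤ b) {a ε c : ℝ} (hε : 0 < ε) :
    π {Q | P₀.withDensity (fun x => ENNReal.ofReal (Real.exp (-U x))) ≤ (Q : Measure Ω)} *
      ∫⁻ x in {x | ∑ i, f (x i) ≤ n * a} ∩ {x | ∑ i, U (x i) ≤ n * c},
        post x {Q | a + ε ≤ ∫ x, f x ∂(Q : Measure Ω)} ∂(Measure.pi fun _ : Fin n => P₀) ≤
      ENNReal.ofReal (Real.exp (-(n * (ε ^ 2 / (2 * b ^ 2) - c)))) := by
  set B : Set (ProbabilityMeasure Ω) := {Q | a + ε ≤ ∫ x, f x ∂(Q : Measure Ω)} with hBdef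
  set D : Set (Fin n → Ω) := {x | ∑ i, f (x i) ≤ n * a} with hDdef
  set E : Set (Fin n → Ω) := {x | ∑ i, U (x i) ≤ n * c} with hEdef
  have hB : MeasurableSet B := measurableSet_le measurable_const (measurable_integral_coe hf)
  have hD : MeasurableSet D := measurableSet_le
    (Finset.measurable_sum _ fun i _ => hf.comp (measurable_pi_apply i)) measurable_const
  set w : Ω → ℝ≥0∞ := fun x => ENNReal.ofReal (Real.exp (-U x)) with hw
  have hwm : Measurable w := (Real.measurable_exp.comp hU.neg).ennreal_ofReal
  have hw1 : ∀ x, w x ≤ 1 := fun x => by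
    rw [hw, ← ENNReal.ofReal_one]
    exact ENNReal.ofReal_le_ofReal (Real.exp_le_one_iff.2 (neg_nonpos.2 (hU0 x)))
  have : IsFiniteMeasure (P₀.withDensity w) := by
    refine isFiniteMeasure_withDensity (ne_top_of_le_ne_top ENNReal.one_ne_top ?_)
    exact (lintegral_mono hw1).trans (by simp)
  have hpm : Measurable fun x => post x B := post.measurable_coe hB
  have hprod : Measurable fun x : Fin n → Ω => ∏ i, w (x i) :=
    Finset.measurable_prod _ fun i _ => hwm.comp (measurable_pi_apply i)
  -- Change of measure: on `E` the density `∏ w (x i)` is at least `e^{-nc}`.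
  have h1 : ∫⁻ x in D ∩ E, post x B ∂(Measure.pi fun _ : Fin n => P₀) ≤
      ENNReal.ofReal (Real.exp (n * c)) *
        ∫⁻ x in D, post x B ∂(Measure.pi fun _ : Fin n => P₀.withDensity w) := by
    rw [pi_withDensity P₀ n hwm, restrict_withDensity hD,
      lintegral_withDensity_eq_lintegral_mul _ hprod hpm,
      ← lintegral_const_mul _ (hprod.mul hpm)]
    refine (setLIntegral_mono ((hprod.mul hpm).const_mul _) fun x hx => ?_).trans
      (lintegral_mono_set Set.inter_subset_left)
    rw [Pi.mul_apply, ← mul_assoc]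
    refine le_mul_of_one_le_left zero_le ?_
    simp only [hw]
    rw [← ENNReal.ofReal_prod_of_nonneg fun i _ => (Real.exp_pos _).le, ← Real.exp_sum,
      ← ENNReal.ofReal_mul (Real.exp_pos _).le, ← Real.exp_add, ENNReal.one_le_ofReal,
      Real.one_le_exp_iff, Finset.sum_neg_distrib]
    have := hx.2
    simp only [hEdef, Set.mem_ofPred_eq] at this
    linarith
  have h2 : π {Q | P₀.withDensity w ≤ (Q : Measure Ω)} *
      ∫⁻ x in D, post x B ∂(Measure.pi fun _ : Fin n => P₀.withDensity w) ≤
      ∫⁻ x in D, post x B ∂(sampling Ω n ∘ₘ π) := by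
    rw [← smul_eq_mul, ← lintegral_smul_measure, ← Measure.restrict_smul]
    exact lintegral_mono' (Measure.restrict_mono le_rfl (smul_pi_le_marginal π _ n)) le_rfl
  -- For `Q ∈ B` the mean of `f` exceeds `a` by `ε`, so `D` is a large deviation under `Q`.
  have h3 : ∫⁻ Q in B, sampling Ω n Q D ∂π ≤
      ENNReal.ofReal (Real.exp (-(n * (ε ^ 2 / (2 * b ^ 2))))) := by
    have hle : ∀ Q ∈ B, sampling Ω n Q D ≤
        ENNReal.ofReal (Real.exp (-(n * (ε ^ 2 / (2 * b ^ 2))))) := fun Q hQ =>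
      pi_sum_le_le_exp (Q : Measure Ω) hf hb hfb hε hQ n
    refine (setLIntegral_mono measurable_const hle).trans ?_
    rw [setLIntegral_const]
    exact mul_le_of_le_one_right zero_le prob_le_one
  calc _ ≤ π {Q | P₀.withDensity w ≤ (Q : Measure Ω)} * (ENNReal.ofReal (Real.exp (n * c)) *
        ∫⁻ x in D, post x B ∂(Measure.pi fun _ : Fin n => P₀.withDensity w)) := by gcongr
    _ = ENNReal.ofReal (Real.exp (n * c)) * (π {Q | P₀.withDensity w ≤ (Q : Measure Ω)} *
        ∫⁻ x in D, post x B ∂(Measure.pi fun _ : Fin n => P₀.withDensity w)) := by ring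
    _ ≤ ENNReal.ofReal (Real.exp (n * c)) *
        ENNReal.ofReal (Real.exp (-(n * (ε ^ 2 / (2 * b ^ 2))))) := by
      gcongr
      exact h2.trans ((h.lintegral_eq hD hB).le.trans h3)
    _ = _ := by
      rw [← ENNReal.ofReal_mul (Real.exp_pos _).le, ← Real.exp_add]
      congr 2
      ring

theorem posterior_halfSpace_tendsto_zero {π : Measure (ProbabilityMeasure Ω)}
    [IsProbabilityMeasure π] {Post : (n : ℕ) → Kernel (Fin n → Ω) (ProbabilityMeasure Ω)}
    (hPost : ∀ n, IsPosterior π (Post n)) (P₀ : Measure Ω) [IsProbabilityMeasure P₀]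
    (hKL : KLSupport π P₀) {f : Ω → ℝ} (hf : Measurable f) {b : ℝ}
    (hfb : ∀ x, |f x| ≤ b) {ε : ℝ} (hε : 0 < ε) :
    ∀ᵐ x ∂(Measure.infinitePi fun _ : ℕ => P₀),
      Tendsto (fun n : ℕ => Post n (fun i : Fin n => x i)
        {Q | ∫ y, f y ∂P₀ + ε ≤ ∫ y, f y ∂(Q : Measure Ω)}) atTop (𝓝 0) := by
  obtain ⟨b, hb, hfb⟩ : ∃ b : ℝ, 0 < b ∧ ∀ x, |f x| ≤ b :=
    ⟨|b| + 1, by positivity, fun x => (hfb x).trans ((le_abs_self b).trans (by linarith))⟩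
  -- The Hoeffding exponent for a gap of `ε / 2`. Half of it is spent on `U`, leaving the rate `c /
  -- 2`; the other half of `ε` lets the empirical mean of `f` fall below `a` eventually.
  set c : ℝ := (ε / 2) ^ 2 / (2 * b ^ 2) with hc
  have hcpos : 0 < c := by positivity
  obtain ⟨U, hU, hU0, hUi, hUc, hπ⟩ := hKL (c / 2) (by positivity)
  set a : ℝ := ∫ y, f y ∂P₀ + ε / 2 with ha
  have haε : a + ε / 2 = ∫ y, f y ∂P₀ + ε := by rw [ha]; ring
  set B : Set (ProbabilityMeasure Ω) := {Q | ∫ y, f y ∂P₀ + ε ≤ ∫ y, f y ∂(Q : Measure Ω)}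
  have hB : MeasurableSet B := measurableSet_le measurable_const (measurable_integral_coe hf)
  let A : (n : ℕ) → Set (Fin n → Ω) := fun n =>
    {x | ∑ i, f (x i) ≤ n * a} ∩ {x | ∑ i, U (x i) ≤ n * (c / 2)}
  have hA : ∀ n, MeasurableSet (A n) := fun n => (measurableSet_le
    (Finset.measurable_sum _ fun i _ => hf.comp (measurable_pi_apply i)) measurable_const).inter
    (measurableSet_le
      (Finset.measurable_sum _ fun i _ => hU.comp (measurable_pi_apply i)) measurable_const)
  let ψ : (n : ℕ) → (Fin n → Ω) → ℝ≥0∞ := fun n => (A n).indicator fun x => Post n x B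
  have hψ : ∀ n, Measurable (ψ n) := fun n => ((Post n).measurable_coe hB).indicator (hA n)
  have hr : ∀ n : ℕ, Measurable fun (x : ℕ → Ω) (i : Fin n) => x i := fun n =>
    measurable_pi_lambda _ fun i => measurable_pi_apply _
  set p := π {Q | P₀.withDensity (fun x => ENNReal.ofReal (Real.exp (-U x))) ≤ (Q : Measure Ω)}
  have hptop : p ≠ ∞ := measure_ne_top _ _
  have hbound : ∀ n : ℕ, ∫⁻ x, ψ n (fun i => x i) ∂(Measure.infinitePi fun _ : ℕ => P₀) ≤
      p⁻¹ * ENNReal.ofReal (Real.exp (-(c / 2))) ^ n := fun n => by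
    rw [← lintegral_map (f := ψ n) (hψ n) (hr n), infinitePi_map_fin, lintegral_indicator (hA n),
      ← ENNReal.mul_le_iff_le_inv hπ hptop]
    have := lintegral_posterior_le (hPost n) P₀ hU hU0 hf hb hfb (a := a) (c := c / 2)
      (half_pos hε)
    rw [haε] at this
    refine this.trans (le_of_eq ?_)
    rw [← ENNReal.ofReal_pow (Real.exp_pos _).le, ← Real.exp_nat_mul]
    congr 2
    rw [← hc]
    ring
  -- The geometric bounds are summable, so the truncated posterior masses tend to `0` almost surely;
  -- by the law of large numbers the truncation is eventually inactive.
  have hsum : ∫⁻ x, ∑' n : ℕ, ψ n (fun i => x i) ∂(Measure.infinitePi fun _ : ℕ => P₀) ≠ ∞ := by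
    rw [lintegral_tsum (f := fun n (x : ℕ → Ω) => ψ n fun i => x i)
      fun n => ((hψ n).comp (hr n)).aemeasurable]
    refine ne_top_of_le_ne_top ?_ (ENNReal.tsum_le_tsum hbound)
    rw [ENNReal.tsum_mul_left, ENNReal.tsum_geometric]
    refine ENNReal.mul_ne_top (ENNReal.inv_ne_top.2 hπ) (ENNReal.inv_ne_top.2 ?_)
    refine (tsub_pos_of_lt ?_).ne'
    rw [← ENNReal.ofReal_one]
    exact (ENNReal.ofReal_lt_ofReal_iff one_pos).2 (Real.exp_lt_one_iff.2 (by linarith))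
  have hfi : Integrable f P₀ := Integrable.of_bound hf.aestronglyMeasurable b (ae_of_all _ hfb)
  filter_upwards [ae_lt_top (Measurable.tsum fun n => (hψ n).comp (hr n)) hsum,
    strong_law_infinitePi P₀ hf hfi, strong_law_infinitePi P₀ hU hUi] with x hx hxf hxU
  refine (ENNReal.tendsto_atTop_zero_of_tsum_ne_top hx.ne).congr' ?_
  filter_upwards [hxf.eventually_lt_const (show ∫ y, f y ∂P₀ < a by rw [ha]; linarith),
    hxU.eventually_lt_const hUc, eventually_gt_atTop 0] with n h1 h2 hn
  have hn' : (0 : ℝ) < n := Nat.cast_pos.2 hn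
  rw [div_lt_iff₀ hn'] at h1 h2
  have hmem : (fun i : Fin n => x i) ∈ A n :=
    ⟨by simpa [mul_comm] using h1.le, by simpa [mul_comm] using h2.le⟩
  exact Set.indicator_of_mem hmem fun y => Post n y B

end Schwartz

/-! ### From half spaces to all weak neighborhoods. -/

section WeakTopology

variable {Ω : Type*} [TopologicalSpace Ω] [MeasurableSpace Ω] [BorelSpace Ω]

theorem weakNhd_mem_nhds (P₀ : ProbabilityMeasure Ω) {K : ℕ} (f : Fin K → Ω →ᵇ ℝ) {ε : Fin K → ℝ}
    (hε : ∀ i, 0 < ε i) : weakNhd P₀ f ε ∈ 𝓝 P₀ := by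
  have h := fun i => ProbabilityMeasure.tendsto_iff_forall_integral_tendsto.1
    (tendsto_id (α := ProbabilityMeasure Ω) (x := 𝓝 P₀)) (f i)
  have : ∀ i, ∀ᶠ Q : ProbabilityMeasure Ω in 𝓝 P₀,
      |∫ x, f i x ∂(Q : Measure Ω) - ∫ x, f i x ∂(P₀ : Measure Ω)| < ε i := fun i => by
    have := (h i).eventually (Metric.ball_mem_nhds _ (hε i))
    simpa [Real.dist_eq] using this
  exact eventually_all.2 this

/-- **Schwartz's theorem** for the weak topology. -/
theorem posterior_consistent_of_klSupport [TopologicalSpace.PseudoMetrizableSpace Ω]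
    [TopologicalSpace.SeparableSpace Ω] {π : Measure (ProbabilityMeasure Ω)}
    [IsProbabilityMeasure π] {Post : (n : ℕ) → Kernel (Fin n → Ω) (ProbabilityMeasure Ω)}
    (hPost : ∀ n, IsPosterior π (Post n)) (P₀ : ProbabilityMeasure Ω)
    (hKL : KLSupport π (P₀ : Measure Ω)) :
    ∀ᵐ x ∂(Measure.infinitePi fun _ : ℕ => (P₀ : Measure Ω)), ∀ V ∈ 𝓝 P₀,
      Tendsto (fun n : ℕ => Post n (fun i : Fin n => x i) V) atTop (𝓝 1) := by
  -- The sets whose complement almost surely loses all posterior mass form a filter. Testing its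
  -- convergence to `P₀` on bounded continuous functions needs only two half spaces at a time.
  let H : Filter (ProbabilityMeasure Ω) :=
    { sets := {V | ∀ᵐ x ∂(Measure.infinitePi fun _ : ℕ => (P₀ : Measure Ω)),
        Tendsto (fun n : ℕ => Post n (fun i : Fin n => x i) Vᶜ) atTop (𝓝 0)}
      univ_sets := by simp
      sets_of_superset := fun {V W} hV hVW => by
        change ∀ᵐ x ∂_, Tendsto _ _ _
        filter_upwards [hV] with x hx
        exact tendsto_of_tendsto_of_tendsto_of_le_of_le tendsto_const_nhds hx
          (fun _ => zero_le) fun n => measure_mono (Set.compl_subset_compl.2 hVW)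
      inter_sets := fun {V W} hV hW => by
        change ∀ᵐ x ∂_, Tendsto _ _ _
        filter_upwards [hV, hW] with x hx hy
        have := hx.add hy
        rw [add_zero] at this
        refine tendsto_of_tendsto_of_tendsto_of_le_of_le tendsto_const_nhds this
          (fun _ => zero_le) fun n => ?_
        dsimp only
        rw [Set.compl_inter]
        exact measure_union_le _ _ }
  have hH : Tendsto id H (𝓝 P₀) := by
    refine ProbabilityMeasure.tendsto_iff_forall_integral_tendsto.2 fun f => ?_
    refine Metric.tendsto_nhds.2 fun ε hε => ?_
    have hf : Measurable f := f.continuous.measurable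
    have h1 := posterior_halfSpace_tendsto_zero hPost (P₀ : Measure Ω) hKL hf
      (fun x => f.norm_coe_le_norm x) hε
    have h2 := posterior_halfSpace_tendsto_zero hPost (P₀ : Measure Ω) hKL hf.neg
      (fun x => by rw [Pi.neg_apply, abs_neg]; exact f.norm_coe_le_norm x) hε
    change ∀ᵐ x ∂_, Tendsto _ _ _
    filter_upwards [h1, h2] with x hx hy
    have := hx.add hy
    rw [add_zero] at this
    refine tendsto_of_tendsto_of_tendsto_of_le_of_le tendsto_const_nhds this
      (fun _ => zero_le) fun n => ?_
    refine (measure_mono ?_).trans (measure_union_le _ _)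
    intro Q hQ
    simp only [Set.mem_compl_iff, Set.mem_ofPred_eq, id, Real.dist_eq, not_lt, Set.mem_union,
      Pi.neg_apply, integral_neg] at hQ ⊢
    rcases le_abs.1 hQ with h | h
    · left; linarith
    · right; linarith
  -- A countable basis makes the exceptional null set independent of the neighborhood.
  obtain ⟨V, hV⟩ := (𝓝 P₀).exists_antitone_basis
  have hae : ∀ j, ∀ᵐ x ∂(Measure.infinitePi fun _ : ℕ => (P₀ : Measure Ω)),
      Tendsto (fun n : ℕ => Post n (fun i : Fin n => x i) (V j)ᶜ) atTop (𝓝 0) := fun j =>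
    hH (hV.1.mem_of_mem trivial)
  filter_upwards [ae_all_iff.2 hae] with x hx W hW
  obtain ⟨j, -, hj⟩ := hV.1.mem_iff.1 hW
  have := fun n => (hPost n).markov
  have hlim : Tendsto (fun n : ℕ => 1 - Post n (fun i : Fin n => x i) (V j)ᶜ) atTop (𝓝 1) := by
    have := ENNReal.Tendsto.sub (tendsto_const_nhds (x := (1 : ℝ≥0∞))) (hx j)
      (Or.inl ENNReal.one_ne_top)
    simpa using this
  refine tendsto_of_tendsto_of_tendsto_of_le_of_le hlim tendsto_const_nhds (fun n => ?_)
    fun n => prob_le_one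
  dsimp only
  rw [tsub_le_iff_right, ← measure_univ (μ := Post n fun i : Fin n => x i),
    ← Set.union_compl_self (V j)]
  exact (measure_union_le _ _).trans (by gcongr)

end WeakTopology

/-! ### Dyadic partitions: cells, filtration and comparison of measures. -/

namespace PartitionTree

variable {Ω : Type*} [mΩ : MeasurableSpace Ω] (T : PartitionTree Ω)

theorem measurableSet_cell (s : List Bool) : MeasurableSet (T.cell s) := by
  have : MeasurableSet[MeasurableSpace.generateFrom (Set.range T.cell)] (T.cell s) :=
    MeasurableSpace.measurableSet_generateFrom ⟨s, rfl⟩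
  rwa [← T.generates] at this

theorem cell_cons_subset (b : Bool) (s : List Bool) : T.cell (b :: s) ⊆ T.cell s := by
  rw [T.cell_union s]
  cases b
  · exact Set.subset_union_left
  · exact Set.subset_union_right

theorem cell_append_subset (u s : List Bool) : T.cell (u ++ s) ⊆ T.cell s := by
  induction u with
  | nil => rfl
  | cons b u ih => exact (T.cell_cons_subset b _).trans ih

theorem disjoint_cell_of_length_eq {s w : List Bool} (h : s.length = w.length) (hne : s ≠ w) :
    Disjoint (T.cell s) (T.cell w) := by
  induction s generalizing w with
  | nil => exact absurd (List.length_eq_zero_iff.1 h.symm).symm hne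
  | cons b s ih =>
    cases w with
    | nil => simp at h
    | cons b' w =>
      by_cases hsw : s = w
      · subst hsw
        have hb : b ≠ b' := fun e => hne (by rw [e])
        have := T.cell_disjoint s
        cases b <;> cases b'
        · exact absurd rfl hb
        · exact this
        · exact this.symm
        · exact absurd rfl hb
      · exact (ih (by simpa using h) hsw).mono (T.cell_cons_subset b s) (T.cell_cons_subset b' w)

theorem eq_append_or_disjoint {s w : List Bool} (h : w.length ≤ s.length) :
    (∃ u, s = u ++ w) ∨ Disjoint (T.cell s) (T.cell w) := by
  have hs : s = s.take (s.length - w.length) ++ s.drop (s.length - w.length) :=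
    (List.take_append_drop _ _).symm
  by_cases hw : s.drop (s.length - w.length) = w
  · exact Or.inl ⟨_, by rw [hw] at hs; exact hs⟩
  · right
    have hl : (s.drop (s.length - w.length)).length = w.length := by
      rw [List.length_drop]; omega
    refine (T.disjoint_cell_of_length_eq hl hw).mono_left ?_
    conv_lhs => rw [hs]
    exact T.cell_append_subset _ _

theorem isPiSystem_range_cell : IsPiSystem (Set.range T.cell) := by
  have key : ∀ s w : List Bool, w.length ≤ s.length → (T.cell s ∩ T.cell w).Nonempty →
      T.cell s ∩ T.cell w = T.cell s := fun s w h hne => by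
    rcases T.eq_append_or_disjoint h with ⟨u, rfl⟩ | hd
    · exact Set.inter_eq_left.2 (T.cell_append_subset u w)
    · exact absurd hne (Set.not_nonempty_iff_eq_empty.2 hd.inter_eq)
  rintro _ ⟨s, rfl⟩ _ ⟨w, rfl⟩ hne
  rcases le_total w.length s.length with h | h
  · exact ⟨s, (key s w h hne).symm⟩
  · rw [Set.inter_comm] at hne ⊢
    exact ⟨w, (key w s h hne).symm⟩

theorem measureReal_cell_add (Q : Measure Ω) [IsFiniteMeasure Q] (s : List Bool) :
    Q.real (T.cell s) = Q.real (T.cell (false :: s)) + Q.real (T.cell (true :: s)) := by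
  conv_lhs => rw [T.cell_union s]
  exact measureReal_union (T.cell_disjoint s) (T.measurableSet_cell _)

/-- The filtration generated by the partitions. -/
def filtration : Filtration ℕ mΩ where
  seq k := MeasurableSpace.generateFrom (T.cell '' {s | s.length ≤ k})
  mono' _ _ hij := MeasurableSpace.generateFrom_mono (Set.image_mono fun _ hs => le_trans hs hij)
  le' _ := MeasurableSpace.generateFrom_le fun _ ⟨s, _, hs⟩ => hs ▸ T.measurableSet_cell s

theorem measurableSet_filtration_cell {s : List Bool} {k : ℕ} (hs : s.length ≤ k) :
    MeasurableSet[T.filtration k] (T.cell s) :=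
  MeasurableSpace.measurableSet_generateFrom ⟨s, hs, rfl⟩

theorem iSup_filtration : ⨆ k, T.filtration k = mΩ := by
  refine le_antisymm (iSup_le fun k => T.filtration.le k) ?_
  conv_lhs => rw [T.generates]
  refine MeasurableSpace.generateFrom_le ?_
  rintro _ ⟨s, rfl⟩
  exact le_iSup (fun k => T.filtration k) s.length _ (T.measurableSet_filtration_cell le_rfl)

/-- The level-`k` cells behave as atoms: the property holds for the generators by nestedness and is
stable under complements and countable unions. -/
theorem subset_or_disjoint_of_measurableSet_filtration {k : ℕ} {w : List Bool} (hw : w.length = k)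
    {B : Set Ω} (hB : MeasurableSet[T.filtration k] B) :
    T.cell w ⊆ B ∨ Disjoint (T.cell w) B := by
  refine MeasurableSpace.generateFrom_induction (T.cell '' {s | s.length ≤ k})
    (fun B _ => T.cell w ⊆ B ∨ Disjoint (T.cell w) B) ?_ ?_ ?_ ?_ B hB
  · rintro _ ⟨s, hs, rfl⟩ -
    rcases T.eq_append_or_disjoint (show s.length ≤ w.length from hs.trans hw.ge) with ⟨u, rfl⟩ | h
    · exact Or.inl (T.cell_append_subset u s)
    · exact Or.inr h
  · exact Or.inr (Set.disjoint_empty _)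
  · rintro t - (h | h)
    · exact Or.inr (Set.disjoint_compl_right_iff_subset.2 h)
    · exact Or.inl h.subset_compl_right
  · intro f _ h
    by_cases hex : ∃ n, T.cell w ⊆ f n
    · obtain ⟨n, hn⟩ := hex
      exact Or.inl (hn.trans (Set.subset_iUnion f n))
    · push Not at hex
      exact Or.inr (Set.disjoint_iUnion_right.2 fun n => (h n).resolve_left (hex n))

theorem eq_of_measurable_filtration {k : ℕ} {w : List Bool} (hw : w.length = k) {g : Ω → ℝ}
    (hg : Measurable[T.filtration k] g) {x y : Ω} (hx : x ∈ T.cell w) (hy : y ∈ T.cell w) :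
    g y = g x := by
  rcases T.subset_or_disjoint_of_measurableSet_filtration hw
    (hg (measurableSet_singleton (g x))) with h | h
  · exact h hy
  · exact absurd rfl (Set.disjoint_left.1 h hx)

theorem measure_le_of_forall_cell {ν Q : Measure Ω} (k : ℕ)
    (h : ∀ w : List Bool, w.length = k → ∀ B, MeasurableSet B →
      ν (B ∩ T.cell w) ≤ Q (B ∩ T.cell w)) : ν ≤ Q := by
  have key : ∀ j : ℕ, ∀ w : List Bool, w.length + j = k → ∀ B, MeasurableSet B →
      ν (B ∩ T.cell w) ≤ Q (B ∩ T.cell w) := fun j => by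
    induction j with
    | zero => exact h
    | succ j ih =>
      intro w hw B hB
      have hsplit : ∀ ρ : Measure Ω, ρ (B ∩ T.cell w) =
          ρ (B ∩ T.cell (false :: w)) + ρ (B ∩ T.cell (true :: w)) := fun ρ => by
        rw [T.cell_union w, Set.inter_union_distrib_left]
        exact measure_union ((T.cell_disjoint w).mono Set.inter_subset_right Set.inter_subset_right)
          (hB.inter (T.measurableSet_cell _))
      rw [hsplit, hsplit]
      exact add_le_add (ih _ (by simp; omega) B hB) (ih _ (by simp; omega) B hB)
  refine Measure.le_iff.2 fun B hB => ?_
  simpa [T.cell_root] using key k [] (by simp) B hB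

/-- If `Q` and `Q₀` have the same probability assignment coefficients below the node `w`, then
they are proportional on `w`. -/
theorem measureReal_inter_cell_mul {Q Q₀ : Measure Ω} [IsFiniteMeasure Q] [IsFiniteMeasure Q₀]
    {w : List Bool}
    (h : ∀ u : List Bool, Q.real (T.cell (u ++ w)) * Q₀.real (T.cell w) =
      Q.real (T.cell w) * Q₀.real (T.cell (u ++ w))) {B : Set Ω} (hB : MeasurableSet B) :
    Q.real (B ∩ T.cell w) * Q₀.real (T.cell w) = Q.real (T.cell w) * Q₀.real (B ∩ T.cell w) := by
  have hfin₁ : IsFiniteMeasure (Q₀ (T.cell w) • Q.restrict (T.cell w)) :=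
    ⟨by simpa using ENNReal.mul_lt_top (measure_lt_top _ _) (measure_lt_top _ _)⟩
  -- Cross-multiplication avoids dividing by a cell mass that may vanish; equality is checked on the
  -- π-system of cells.
  have key : Q₀ (T.cell w) • Q.restrict (T.cell w) = Q (T.cell w) • Q₀.restrict (T.cell w) := by
    refine ext_of_generate_finite _ T.generates T.isPiSystem_range_cell ?_ ?_
    · rintro _ ⟨s, rfl⟩
      rw [Measure.smul_apply, Measure.smul_apply, Measure.restrict_apply (T.measurableSet_cell s),
        Measure.restrict_apply (T.measurableSet_cell s), smul_eq_mul, smul_eq_mul]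
      rcases le_total w.length s.length with hl | hl
      · rcases T.eq_append_or_disjoint hl with ⟨u, rfl⟩ | hd
        · rw [Set.inter_eq_left.2 (T.cell_append_subset u w)]
          have := h u
          simp only [measureReal_def, ← ENNReal.toReal_mul] at this
          rw [mul_comm]
          exact (ENNReal.toReal_eq_toReal_iff'
            (ENNReal.mul_ne_top (measure_ne_top _ _) (measure_ne_top _ _))
            (ENNReal.mul_ne_top (measure_ne_top _ _) (measure_ne_top _ _))).1 this
        · simp [hd.inter_eq]
      · rcases T.eq_append_or_disjoint hl with ⟨u, rfl⟩ | hd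
        · rw [Set.inter_eq_right.2 (T.cell_append_subset u s), mul_comm]
        · simp [hd.symm.inter_eq]
    · simp [mul_comm]
  have := congrArg (fun ρ : Measure Ω => (ρ B).toReal) key
  simp only [Measure.smul_apply, Measure.restrict_apply hB, smul_eq_mul, ENNReal.toReal_mul] at this
  rw [mul_comm]
  exact this

/-- On a level-`k` cell the conditional expectation is constant and `Q` is proportional to `Q₀`, so
comparing total cell masses suffices. -/
theorem withDensity_condExp_le {Q Q₀ : Measure Ω} [IsFiniteMeasure Q] [IsFiniteMeasure Q₀]
    {g : Ω → ℝ} (hg : Integrable g Q₀) {k : ℕ} {r : ℝ}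
    (hw : ∀ w : List Bool, w.length = k → r * ∫ x in T.cell w, g x ∂Q₀ ≤ Q.real (T.cell w))
    (hu : ∀ w : List Bool, w.length = k → ∀ u : List Bool,
      Q.real (T.cell (u ++ w)) * Q₀.real (T.cell w) =
        Q.real (T.cell w) * Q₀.real (T.cell (u ++ w))) :
    Q₀.withDensity (fun x => ENNReal.ofReal (r * (Q₀[g | T.filtration k]) x)) ≤ Q := by
  refine T.measure_le_of_forall_cell k fun w hwk B hB => ?_
  have hBw := hB.inter (T.measurableSet_cell w)
  rw [withDensity_apply _ hBw]
  by_cases h0 : Q₀ (T.cell w) = 0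
  · rw [setLIntegral_measure_zero _ _ (measure_mono_null Set.inter_subset_right h0)]
    exact zero_le
  have hpos : 0 < Q₀.real (T.cell w) := ENNReal.toReal_pos h0 (measure_ne_top _ _)
  obtain ⟨x, hx⟩ : (T.cell w).Nonempty := nonempty_of_measure_ne_zero h0
  set ψ := Q₀[g | T.filtration k] with hψ
  have hconst : ∀ y ∈ T.cell w, ψ y = ψ x := fun y hy =>
    T.eq_of_measurable_filtration hwk stronglyMeasurable_condExp.measurable hx hy
  have hint : ψ x * Q₀.real (T.cell w) = ∫ y in T.cell w, g y ∂Q₀ := by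
    rw [← setIntegral_condExp (T.filtration.le k) hg (T.measurableSet_filtration_cell hwk.le),
      setIntegral_congr_fun (T.measurableSet_cell w) hconst, setIntegral_const, smul_eq_mul,
      mul_comm]
  rw [setLIntegral_congr_fun hBw (g := fun _ => ENNReal.ofReal (r * ψ x))
    fun y hy => by rw [hconst y hy.2], setLIntegral_const, ← ofReal_measureReal (μ := Q₀),
    ← ofReal_measureReal (μ := Q), ← ENNReal.ofReal_mul' measureReal_nonneg]
  refine ENNReal.ofReal_le_ofReal (le_of_mul_le_mul_right ?_ hpos)
  rw [T.measureReal_inter_cell_mul (hu w hwk) hB]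
  have := mul_le_mul_of_nonneg_right (hw w hwk) (measureReal_nonneg (μ := Q₀) (s := B ∩ T.cell w))
  rw [← hint] at this
  calc r * ψ x * Q₀.real (B ∩ T.cell w) * Q₀.real (T.cell w)
      = r * (ψ x * Q₀.real (T.cell w)) * Q₀.real (B ∩ T.cell w) := by ring
    _ ≤ _ := this

end PartitionTree

/-! ### Positivity of Beta mixtures on intervals. -/

theorem continuousAt_realGamma {x : ℝ} (hx : 0 < x) : ContinuousAt Real.Gamma x :=
  (Real.differentiableAt_Gamma fun m => by
    have : (0 : ℝ) ≤ m := m.cast_nonneg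
    linarith).continuousAt

/-- Since `α - 1 ≤ N` and `0 < x < 1`, `x ^ (α - 1) ≥ x ^ N ≥ a ^ N`, and likewise for `1 - x`. The
bound depends on `α` and `β` only through the continuous function `beta`. -/
theorem le_betaMeasure_Ioo {α β a b N : ℝ} (hα : 0 < α) (hβ : 0 < β) (hαN : α ≤ N) (hβN : β ≤ N)
    (ha : 0 < a) (hb : b < 1) :
    ENNReal.ofReal (1 / beta α β * a ^ N * (1 - b) ^ N) * volume (Set.Ioo a b) ≤
      betaMeasure α β (Set.Ioo a b) := by
  rw [betaMeasure, withDensity_apply _ measurableSet_Ioo, ← setLIntegral_const]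
  refine setLIntegral_mono' measurableSet_Ioo fun x hx => ?_
  have hx0 : 0 < x := ha.trans hx.1
  have hx1 : x < 1 := hx.2.trans hb
  rw [betaPDF_of_pos_lt_one hx0 hx1]
  refine ENNReal.ofReal_le_ofReal ?_
  have hN : 0 ≤ N := hα.le.trans hαN
  have h1 : a ^ N ≤ x ^ (α - 1) :=
    (Real.rpow_le_rpow ha.le hx.1.le hN).trans
      (Real.rpow_le_rpow_of_exponent_ge hx0 hx1.le (by linarith))
  have h2 : (1 - b) ^ N ≤ (1 - x) ^ (β - 1) :=
    (Real.rpow_le_rpow (by linarith) (by linarith [hx.2]) hN).trans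
      (Real.rpow_le_rpow_of_exponent_ge (by linarith) (by linarith) (by linarith))
  have h3 := (one_div_pos.2 (beta_pos hα hβ)).le
  have h4 : 0 ≤ a ^ N := Real.rpow_nonneg ha.le _
  have h5 : 0 ≤ (1 - b) ^ N := Real.rpow_nonneg (by linarith) _
  gcongr

theorem lintegral_betaMeanPrec_ne_zero {F : Measure ℝ≥0∞} {N : ℝ≥0}
    (hF : F (Set.Ioc 0 (N : ℝ≥0∞)) ≠ 0) {t : ℝ} (ht0 : 0 < t) (ht1 : t < 1) {T : Set ℝ} {a b : ℝ}
    (ha : 0 ≤ a) (hab : a < b) (hb : b ≤ 1) (hT : Set.Ioo a b ⊆ T) :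
    ∫⁻ v in Set.univ, betaMeanPrec t v T ∂F ≠ 0 := by
  obtain ⟨a', ha', ha'b⟩ := exists_between hab
  obtain ⟨b', hab', hb'⟩ := exists_between ha'b
  have ha0 : 0 < a' := ha.trans_lt ha'
  have hb1 : b' < 1 := hb'.trans_le hb
  -- A positive minorant, measurable in `v` on `(0, N]`; no measurability of `betaMeanPrec t v T` in
  -- `v` is then needed. Shrinking to `(a', b')` keeps the density bound positive.
  set h : ℝ≥0∞ → ℝ≥0∞ := fun v => ENNReal.ofReal
    (1 / beta (t * v.toReal) ((1 - t) * v.toReal) * a' ^ (N : ℝ) * (1 - b') ^ (N : ℝ)) *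
      volume (Set.Ioo a' b') with hh
  have hv : ∀ v ∈ Set.Ioc 0 (N : ℝ≥0∞), v ≠ ∞ ∧ 0 < v.toReal ∧ v.toReal ≤ N := fun v hv => by
    have hv' : v ≠ ∞ := ne_top_of_le_ne_top ENNReal.coe_ne_top hv.2
    exact ⟨hv', ENNReal.toReal_pos hv.1.ne' hv',
      by simpa using ENNReal.toReal_mono ENNReal.coe_ne_top hv.2⟩
  have hle : ∀ v ∈ Set.Ioc 0 (N : ℝ≥0∞), h v ≤ betaMeanPrec t v T := fun v hvN => by
    obtain ⟨hvt, hv0, hvN⟩ := hv v hvN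
    rw [betaMeanPrec, if_neg (by simp [hvt, ht0, ht1])]
    refine (le_betaMeasure_Ioo (by positivity) (mul_pos (by linarith) hv0) ?_ ?_ ha0 hb1).trans
      (measure_mono ((Set.Ioo_subset_Ioo ha'.le hb'.le).trans hT)) <;> nlinarith
  have hcont : ContinuousOn (fun v : ℝ≥0∞ => beta (t * v.toReal) ((1 - t) * v.toReal))
      (Set.Ioc 0 (N : ℝ≥0∞)) := fun v hvN => by
    obtain ⟨hvt, hv0, -⟩ := hv v hvN
    have hr : ContinuousAt ENNReal.toReal v := ENNReal.tendsto_toReal hvt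
    have h1 : 0 < t * v.toReal := by positivity
    have h2 : 0 < (1 - t) * v.toReal := mul_pos (by linarith) hv0
    have hG : ∀ u : ℝ≥0∞ → ℝ, ContinuousAt u v → 0 < u v →
        ContinuousAt (fun v => Real.Gamma (u v)) v := fun u hu hpos =>
      ContinuousAt.comp (f := u) (g := Real.Gamma) (continuousAt_realGamma hpos) hu
    have c1 := hr.const_mul t
    have c2 := hr.const_mul (1 - t)
    exact (((hG _ c1 h1).mul (hG _ c2 h2)).div (hG _ (c1.add c2) (add_pos h1 h2))
      (Real.Gamma_pos_of_pos (add_pos h1 h2)).ne').continuousWithinAt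
  have hmeas : AEMeasurable h (F.restrict (Set.Ioc 0 (N : ℝ≥0∞))) := by
    have hbm := hcont.aemeasurable (μ := F) measurableSet_Ioc
    exact ((((aemeasurable_const.div hbm).mul_const _).mul_const _).ennreal_ofReal).mul_const _
  have hpos : ∀ v ∈ Set.Ioc 0 (N : ℝ≥0∞), h v ≠ 0 := fun v hvN => by
    obtain ⟨-, hv0, -⟩ := hv v hvN
    refine mul_ne_zero (ENNReal.ofReal_pos.2 ?_).ne' (by simp [hab'])
    have := beta_pos (mul_pos ht0 hv0) (mul_pos (sub_pos.2 ht1) hv0)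
    have := Real.rpow_pos_of_pos ha0 N
    have := Real.rpow_pos_of_pos (sub_pos.2 hb1) N
    positivity
  intro h0
  have hzero : ∫⁻ v in Set.Ioc 0 (N : ℝ≥0∞), h v ∂F = 0 := by
    refine le_antisymm ?_ zero_le
    exact ((setLIntegral_mono' measurableSet_Ioc hle).trans
      (lintegral_mono_set (Set.subset_univ _))).trans h0.le
  rw [lintegral_eq_zero_iff' hmeas, EventuallyEq, ae_restrict_iff' measurableSet_Ioc] at hzero
  refine hF (measure_mono_null (fun v hvN => ?_) (ae_iff.1 hzero))
  simp only [Set.mem_ofPred_eq, Classical.not_imp]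
  exact ⟨hvN, hpos v hvN⟩

theorem mem_nodesUpTo {n : ℕ} {s : List Bool} : s ∈ nodesUpTo n ↔ s.length ≤ n := by
  simp [nodesUpTo]

theorem pmf_apply_eq_one {α : Type*} (p : PMF α) (a : α) (h : ∀ b, b ≠ a → p b = 0) : p a = 1 := by
  rw [← p.tsum_coe, tsum_eq_single a h]

/-! ### Complete shrinkage below a given level. -/

section Model

variable {Ω : Type*} [MeasurableSpace Ω] {m : ℕ} {P : Params Ω m}

theorem Params.lintegral_last (hF : ∀ s, P.F s (Fin.last m) = Measure.dirac ∞) (s : List Bool) :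
    ∫⁻ v in Set.univ, betaMeanPrec (P.θ₀ s) v {P.θ₀ s} ∂(P.F s (Fin.last m)) = 1 := by
  rw [hF, Measure.restrict_univ, lintegral_dirac, betaMeanPrec, if_pos (Or.inl rfl)]
  simp

/-- With positive probability, all nodes of level at least `k` are in the complete shrinkage state
while the coefficients of the nodes of lower level belong to prescribed sets. -/
theorem IsHierarchicalModel.measure_ne_zero (hincr : P.StochasticallyIncreasing)
    (hF : ∀ s, P.F s (Fin.last m) = Measure.dirac ∞) {k : ℕ}
    (htrans : ∀ s : List Bool, s.length = k → ∀ i, i ≠ Fin.last m →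
      P.trans s i (Fin.last m) ≠ 0) (hk : 0 < k) {N : ℝ≥0}
    (hN : ∀ s i, i ≠ Fin.last m → P.F s i (Set.Ioc 0 (N : ℝ≥0∞)) ≠ 0)
    (havoid : P.ShrinkageAvoidable)
    {S : Type*} [MeasurableSpace S] {Pr : Measure S} [IsFiniteMeasure Pr]
    {C : List Bool → S → Fin (m + 1)} {ν : List Bool → S → ℝ≥0∞} {θ : List Bool → S → ℝ}
    (hM : IsHierarchicalModel P Pr C ν θ) {T : List Bool → Set ℝ}
    (hTm : ∀ s, MeasurableSet (T s))
    (hT : ∀ s : List Bool, 0 < P.θ₀ s → P.θ₀ s < 1 →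
      ∃ a b, 0 ≤ a ∧ a < b ∧ b ≤ 1 ∧ Set.Ioo a b ⊆ T s)
    (hT' : ∀ s : List Bool, (P.θ₀ s ≤ 0 ∨ 1 ≤ P.θ₀ s) → P.θ₀ s ∈ T s) :
    Pr {ω | (∀ s : List Bool, s.length < k → θ s ω ∈ T s) ∧
      ∀ s : List Bool, k ≤ s.length → θ s ω = P.θ₀ s} ≠ 0 := by
  -- The configuration avoids state `I` through level `k - 1` and sits in it from level `k` on; `0 <
  -- k` keeps the root among the unshrunk nodes.
  obtain ⟨c₀, hc₀⟩ := havoid (k - 1)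
  let c : List Bool → Fin (m + 1) := fun s => if s.length < k then c₀ s else Fin.last m
  let T' : List Bool → Set ℝ := fun s => if s.length < k then T s else {P.θ₀ s}
  have hc : ∀ s : List Bool, s.length < k → c s = c₀ s := fun s hs => if_pos hs
  have hcl : ∀ s : List Bool, ¬ s.length < k → c s = Fin.last m := fun s hs => if_neg hs
  have hT's : ∀ s : List Bool, s.length < k → T' s = T s := fun s hs => if_pos hs
  have hT'l : ∀ s : List Bool, ¬ s.length < k → T' s = {P.θ₀ s} := fun s hs => if_neg hs
  have hT'm : ∀ s, MeasurableSet (T' s) := fun s => by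
    by_cases hs : s.length < k
    · rw [hT's s hs]; exact hTm s
    · rw [hT'l s hs]; exact measurableSet_singleton _
  let E : ℕ → Set S := fun n => {ω | ∀ s ∈ nodesUpTo n, C s ω = c s ∧ ν s ω ∈ Set.univ ∧
    θ s ω ∈ T' s}
  let φ : List Bool → ℝ≥0∞ := fun s =>
    P.stateProb c s * ∫⁻ v in Set.univ, betaMeanPrec (P.θ₀ s) v (T' s) ∂(P.F s (c s))
  have hE : ∀ n, Pr (E n) = ∏ s ∈ nodesUpTo n, φ s := fun n =>
    hM.law n c (fun _ => Set.univ) T' (fun _ => MeasurableSet.univ) hT'm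
  -- State `I` is absorbing because the transitions are upper triangular, and infinite precision
  -- fixes the coefficient. So only the finitely many factors up to level `k` matter.
  have hφ1 : ∀ s : List Bool, k < s.length → φ s = 1 := fun s hs => by
    have hst : P.stateProb c s = 1 := by
      cases s with
      | nil => simp at hs
      | cons b s =>
        rw [List.length_cons] at hs
        rw [Params.stateProb, hcl s (by omega), hcl (b :: s) (by rw [List.length_cons]; omega)]
        exact pmf_apply_eq_one _ _ fun j hj => hincr b s _ j (Fin.lt_last_iff_ne_last.2 hj)
    simp only [φ]
    rw [hst, hcl s (by omega), hT'l s (by omega), P.lintegral_last hF, one_mul]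
  have hφ0 : ∀ s : List Bool, s.length ≤ k → φ s ≠ 0 := fun s hs => by
    rcases hs.lt_or_eq with hs | hs
    · have hs' := hc₀ s (by omega)
      refine mul_ne_zero ?_ ?_
      · have : P.stateProb c s = P.stateProb c₀ s := by
          cases s with
          | nil => rw [Params.stateProb, Params.stateProb, hc _ hs]
          | cons b s =>
            rw [Params.stateProb, Params.stateProb, hc _ hs,
              hc s (by rw [List.length_cons] at hs; omega)]
        rw [this]
        exact hs'.2.ne'
      · rw [hc s hs, hT's s hs]
        by_cases h0 : 0 < P.θ₀ s ∧ P.θ₀ s < 1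
        · obtain ⟨a, b, ha, hab, hb, hsub⟩ := hT s h0.1 h0.2
          exact lintegral_betaMeanPrec_ne_zero (hN s _ hs'.1) h0.1 h0.2 ha hab hb hsub
        · have h0' : P.θ₀ s ≤ 0 ∨ 1 ≤ P.θ₀ s := by
            rcases not_and_or.1 h0 with h | h
            · exact Or.inl (not_lt.1 h)
            · exact Or.inr (not_lt.1 h)
          have : ∀ v, betaMeanPrec (P.θ₀ s) v (T s) = 1 := fun v => by
            rw [betaMeanPrec, if_pos (Or.inr h0'), Measure.dirac_apply' _ (hTm s),
              Set.indicator_of_mem (hT' s h0'), Pi.one_apply]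
          have := P.F_prob s (c₀ s)
          simp [*]
    · simp only [φ]
      rw [hcl s (by omega), hT'l s (by omega), P.lintegral_last hF, mul_one]
      cases s with
      | nil => simp at hs; omega
      | cons b s =>
        rw [List.length_cons] at hs
        rw [Params.stateProb, hc s (by omega), hcl (b :: s) (by rw [List.length_cons]; omega)]
        exact htrans _ (by rw [List.length_cons]; omega) _ (hc₀ s (by omega)).1
  have hEk : ∀ n, Pr (E (k + n)) = ∏ s ∈ nodesUpTo k, φ s := fun n => by
    rw [hE]
    refine (Finset.prod_subset (fun s hs => ?_) fun s _ hs => hφ1 s ?_).symm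
    · rw [mem_nodesUpTo] at hs ⊢; omega
    · rw [mem_nodesUpTo] at hs; omega
  have hEm : ∀ n, MeasurableSet (E n) := fun n => by
    have : E n = ⋂ s ∈ nodesUpTo n, C s ⁻¹' {c s} ∩ θ s ⁻¹' T' s := by
      ext ω; simp [E]
    rw [this]
    exact Finset.measurableSet_biInter _ fun s _ =>
      (hM.measurable_state s (measurableSet_singleton _)).inter (hM.measurable_pac s (hT'm s))
  have hanti : Antitone fun n => E (k + n) := fun i j hij ω hω s hs =>
    hω s (by rw [mem_nodesUpTo] at hs ⊢; omega)
  -- Continuity from above along a decreasing sequence of events of constant positive probability.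
  have hlim := tendsto_measure_iInter_atTop (μ := Pr) (fun n => (hEm (k + n)).nullMeasurableSet)
    hanti ⟨0, measure_ne_top _ _⟩
  simp only [Function.comp_def, hEk] at hlim
  have hinter : Pr (⋂ n, E (k + n)) ≠ 0 := by
    rw [tendsto_nhds_unique hlim tendsto_const_nhds]
    exact Finset.prod_ne_zero_iff.2 fun s hs => hφ0 s (mem_nodesUpTo.1 hs)
  refine fun h0 => hinter (measure_mono_null (fun ω hω => ?_) h0)
  have hmem : ∀ s : List Bool, θ s ω ∈ T' s := fun s =>
    (Set.mem_iInter.1 hω s.length s (mem_nodesUpTo.2 (by omega))).2.2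
  refine ⟨fun s hs => ?_, fun s hs => ?_⟩
  · rw [← hT's s hs]; exact hmem s
  · have := hmem s
    rwa [hT'l s (by omega)] at this

end Model

/-! ### Kullback–Leibler support of the prior. -/

section Support

variable {Ω : Type*} [mΩ : MeasurableSpace Ω] {m : ℕ} {P : Params Ω m}

theorem Params.θ₀_mul (P : Params Ω m) (s : List Bool) :
    P.θ₀ s * (P.Q₀ : Measure Ω).real (P.tree.cell s) =
      (P.Q₀ : Measure Ω).real (P.tree.cell (false :: s)) := by
  by_cases h : (P.Q₀ : Measure Ω).real (P.tree.cell s) = 0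
  · have := P.tree.measureReal_cell_add (P.Q₀ : Measure Ω) s
    have h1 := measureReal_nonneg (μ := (P.Q₀ : Measure Ω)) (s := P.tree.cell (false :: s))
    have h2 := measureReal_nonneg (μ := (P.Q₀ : Measure Ω)) (s := P.tree.cell (true :: s))
    rw [h, mul_zero]
    linarith
  · exact div_mul_cancel₀ _ h

theorem Params.one_sub_θ₀_mul (P : Params Ω m) (s : List Bool) :
    (1 - P.θ₀ s) * (P.Q₀ : Measure Ω).real (P.tree.cell s) =
      (P.Q₀ : Measure Ω).real (P.tree.cell (true :: s)) := by
  have := P.tree.measureReal_cell_add (P.Q₀ : Measure Ω) s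
  rw [sub_mul, P.θ₀_mul]
  linarith

theorem measureReal_append_mul {Q : Measure Ω} [IsFiniteMeasure Q] {θ : List Bool → ℝ}
    (hQ : ∀ s, Q.real (P.tree.cell (false :: s)) = θ s * Q.real (P.tree.cell s))
    {w : List Bool} (hθ : ∀ u : List Bool, θ (u ++ w) = P.θ₀ (u ++ w)) (u : List Bool) :
    Q.real (P.tree.cell (u ++ w)) * (P.Q₀ : Measure Ω).real (P.tree.cell w) =
      Q.real (P.tree.cell w) * (P.Q₀ : Measure Ω).real (P.tree.cell (u ++ w)) := by
  induction u with
  | nil => rfl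
  | cons b u ih =>
    have hQl := hQ (u ++ w)
    rw [hθ] at hQl
    rw [List.cons_append]
    cases b
    · rw [hQl, ← P.θ₀_mul (u ++ w)]
      linear_combination P.θ₀ (u ++ w) * ih
    · have hadd := P.tree.measureReal_cell_add Q (u ++ w)
      rw [← P.one_sub_θ₀_mul (u ++ w)]
      have hQr : Q.real (P.tree.cell (true :: (u ++ w))) =
          (1 - P.θ₀ (u ++ w)) * Q.real (P.tree.cell (u ++ w)) := by linarith
      rw [hQr]
      linear_combination (1 - P.θ₀ (u ++ w)) * ih

/-- The coefficients that are, up to the factor `r`, at least as favorable to both children as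
those of the measure with cell masses `Γ`. -/
def coeffInterval (r : ℝ) (Γ : List Bool → ℝ) (s : List Bool) : Set ℝ :=
  Set.Icc (r * (Γ (false :: s) / Γ s)) (1 - r * (Γ (true :: s) / Γ s))

/-- Each generation loses at most a factor `r` relative to `Γ`. -/
theorem pow_mul_le_measureReal_cell (T : PartitionTree Ω) {Q : Measure Ω} [IsProbabilityMeasure Q]
    {θ : List Bool → ℝ} (hQ : ∀ s, Q.real (T.cell (false :: s)) = θ s * Q.real (T.cell s))
    {Γ : List Bool → ℝ} (h0 : ∀ s, 0 ≤ Γ s) (hroot : Γ [] ≤ 1)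
    (hadd : ∀ s, Γ s = Γ (false :: s) + Γ (true :: s)) {r : ℝ} (hr : 0 ≤ r) {k : ℕ}
    (hθ : ∀ s : List Bool, s.length < k → θ s ∈ coeffInterval r Γ s) (s : List Bool)
    (hs : s.length ≤ k) : r ^ s.length * Γ s ≤ Q.real (T.cell s) := by
  induction s with
  | nil => simpa [T.cell_root] using hroot
  | cons b s ih =>
    rw [List.length_cons] at hs ⊢
    have ih := ih (by omega)
    obtain ⟨hl, hu⟩ := hθ s (by omega)
    by_cases hΓ : Γ s = 0
    · have hb : Γ (b :: s) = 0 := by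
        have h1 := h0 (false :: s)
        have h2 := h0 (true :: s)
        have h3 := hadd s
        cases b <;> linarith
      rw [hb, mul_zero]
      exact measureReal_nonneg
    · have hq := T.measureReal_cell_add Q s
      have hpos := (h0 s).lt_of_ne' hΓ
      have key : ∀ t x : ℝ, r * (x / Γ s) ≤ t → 0 ≤ x →
          r ^ (s.length + 1) * x ≤ t * Q.real (T.cell s) := fun t x ht hx => by
        have h1 : 0 ≤ r * (x / Γ s) := by positivity
        calc r ^ (s.length + 1) * x = r * (x / Γ s) * (r ^ s.length * Γ s) := by
              field_simp
              ring
          _ ≤ t * Q.real (T.cell s) := mul_le_mul ht ih (by positivity) (h1.trans ht)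
      cases b
      · rw [hQ]
        exact key _ _ hl (h0 _)
      · have hQr : Q.real (T.cell (true :: s)) = (1 - θ s) * Q.real (T.cell s) := by
          linarith [hQ s]
        rw [hQr]
        exact key _ _ (by linarith) (h0 _)

/-- The two child fractions sum to `1`, so the interval has length `1 - r`; at `r = 1` it would
shrink to a point. -/
theorem exists_Ioo_subset_coeffInterval {r : ℝ} (hr : 0 ≤ r) (hr1 : r < 1) {Γ : List Bool → ℝ}
    (h0 : ∀ s, 0 ≤ Γ s) (hadd : ∀ s, Γ s = Γ (false :: s) + Γ (true :: s)) {s : List Bool}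
    (hs : Γ s ≠ 0) :
    ∃ a b, 0 ≤ a ∧ a < b ∧ b ≤ 1 ∧ Set.Ioo a b ⊆ coeffInterval r Γ s := by
  have hl : 0 ≤ Γ (false :: s) / Γ s := div_nonneg (h0 _) (h0 _)
  have ht : 0 ≤ Γ (true :: s) / Γ s := div_nonneg (h0 _) (h0 _)
  have hsum : Γ (false :: s) / Γ s + Γ (true :: s) / Γ s = 1 := by
    rw [← add_div, ← hadd, div_self hs]
  refine ⟨_, _, mul_nonneg hr hl, ?_, ?_, Set.Ioo_subset_Icc_self⟩
  · nlinarith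
  · nlinarith

/-- Covers the nodes whose coefficient is degenerate: one child is null for `Q₀`, hence for `Γ`, and
`θ₀` is then an endpoint of the interval. If `Γ s = 0`, division by zero makes the interval `[0,
1]`. -/
theorem θ₀_mem_coeffInterval {r : ℝ} (hr : 0 ≤ r) (hr1 : r < 1) {Γ : List Bool → ℝ}
    (h0 : ∀ s, 0 ≤ Γ s) (hadd : ∀ s, Γ s = Γ (false :: s) + Γ (true :: s))
    (hiff : ∀ s, Γ s = 0 ↔ (P.Q₀ : Measure Ω).real (P.tree.cell s) = 0) {s : List Bool}
    (hs : P.θ₀ s ≤ 0 ∨ 1 ≤ P.θ₀ s) : P.θ₀ s ∈ coeffInterval r Γ s := by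
  have hθ0 : 0 ≤ P.θ₀ s := div_nonneg measureReal_nonneg measureReal_nonneg
  have hθ1 : P.θ₀ s ≤ 1 := div_le_one_of_le₀
    (measureReal_mono (P.tree.cell_cons_subset false s)) measureReal_nonneg
  by_cases hΓ : Γ s = 0
  · simp [coeffInterval, hΓ, hθ0, hθ1]
  have hl : 0 ≤ Γ (false :: s) / Γ s := div_nonneg (h0 _) (h0 _)
  have ht : 0 ≤ Γ (true :: s) / Γ s := div_nonneg (h0 _) (h0 _)
  have hsum : Γ (false :: s) / Γ s + Γ (true :: s) / Γ s = 1 := by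
    rw [← add_div, ← hadd, div_self hΓ]
  rcases hs with hs | hs
  · have hθ : P.θ₀ s = 0 := le_antisymm hs hθ0
    have h1 := P.θ₀_mul s
    rw [hθ, zero_mul] at h1
    have h2 := (hiff _).2 h1.symm
    rw [hθ, coeffInterval, h2, zero_div, mul_zero]
    exact ⟨le_rfl, by nlinarith⟩
  · have hθ : P.θ₀ s = 1 := le_antisymm hθ1 hs
    have h1 := P.one_sub_θ₀_mul s
    rw [hθ, sub_self, zero_mul] at h1
    have h2 := (hiff _).2 h1.symm
    rw [hθ, coeffInterval, h2, zero_div, mul_zero, sub_zero]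
    exact ⟨by nlinarith, le_rfl⟩

/-- For a probability density `g` bounded away from `0` and `r < 1`, the random measure `Q` is with
positive probability at least `r ^ k` times the discretization of `g` to the partition of level
`k`. -/
theorem IsMarkovAPT.measure_ne_zero (hincr : P.StochasticallyIncreasing)
    (hF : ∀ s, P.F s (Fin.last m) = Measure.dirac ∞) {k : ℕ}
    (htrans : ∀ s : List Bool, s.length = k → ∀ i, i ≠ Fin.last m →
      P.trans s i (Fin.last m) ≠ 0) (hk : 0 < k) {N : ℝ≥0}
    (hN : ∀ s i, i ≠ Fin.last m → P.F s i (Set.Ioc 0 (N : ℝ≥0∞)) ≠ 0)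
    (havoid : P.ShrinkageAvoidable) {π : Measure (ProbabilityMeasure Ω)} (hπ : IsMarkovAPT P π)
    {g : Ω → ℝ} (hg : Integrable g (P.Q₀ : Measure Ω)) {η : ℝ} (hη : 0 < η) (hgη : ∀ x, η ≤ g x)
    (hg1 : ∫ x, g x ∂(P.Q₀ : Measure Ω) ≤ 1) {r : ℝ} (hr : 0 ≤ r) (hr1 : r < 1) :
    π {Q | (P.Q₀ : Measure Ω).withDensity (fun x => ENNReal.ofReal
      (r ^ k * ((P.Q₀ : Measure Ω)[g | P.tree.filtration k]) x)) ≤ (Q : Measure Ω)} ≠ 0 := by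
  obtain ⟨S, _, Pr, C, ν, θ, Q, hPr, hM, hQm, hQ, rfl⟩ := hπ
  set Γ : List Bool → ℝ := fun s => ∫ x in P.tree.cell s, g x ∂(P.Q₀ : Measure Ω) with hΓ
  have hΓη : ∀ s, η * (P.Q₀ : Measure Ω).real (P.tree.cell s) ≤ Γ s := fun s => by
    have := setIntegral_mono (integrable_const η).integrableOn hg.integrableOn hgη
      (s := P.tree.cell s)
    rwa [setIntegral_const, smul_eq_mul, mul_comm] at this
  have h0 : ∀ s, 0 ≤ Γ s := fun s => (by positivity : (0 : ℝ) ≤ _).trans (hΓη s)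
  have hadd : ∀ s, Γ s = Γ (false :: s) + Γ (true :: s) := fun s => by
    simp only [hΓ]
    rw [← setIntegral_union (P.tree.cell_disjoint s) (P.tree.measurableSet_cell _)
      hg.integrableOn hg.integrableOn, ← P.tree.cell_union]
  have hiff : ∀ s, Γ s = 0 ↔ (P.Q₀ : Measure Ω).real (P.tree.cell s) = 0 := fun s => by
    refine ⟨fun h => ?_, fun h => ?_⟩
    · have := hΓη s
      have h' := measureReal_nonneg (μ := (P.Q₀ : Measure Ω)) (s := P.tree.cell s)
      rw [h] at this
      nlinarith
    · exact setIntegral_measure_zero _ ((measureReal_eq_zero_iff).1 h)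
  have hroot : Γ [] ≤ 1 := by simpa [hΓ, P.tree.cell_root] using hg1
  have hpos := hM.measure_ne_zero hincr hF htrans hk hN havoid (T := coeffInterval r Γ)
    (fun s => measurableSet_Icc)
    (fun s hs hs1 => exists_Ioo_subset_coeffInterval hr hr1 h0 hadd fun h => by
      rw [Params.θ₀, (hiff s).1 h, div_zero] at hs
      exact lt_irrefl _ hs)
    (fun s hs => θ₀_mem_coeffInterval hr hr1 h0 hadd hiff hs)
  refine fun hzero => hpos ?_
  -- This inequality for the image measure holds for arbitrary sets, so the domination event need
  -- not be measurable.
  have hzero' := le_antisymm ((Measure.le_map_apply hQm.aemeasurable _).trans hzero.le) zero_le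
  rw [← compl_mem_ae_iff] at hzero' ⊢
  filter_upwards [hzero', hQ] with ω hω hQω
  rintro ⟨h1, h2⟩
  refine hω (P.tree.withDensity_condExp_le hg (fun w hw => ?_) fun w hw u => ?_)
  · have := pow_mul_le_measureReal_cell P.tree hQω h0 hroot hadd hr h1 w hw.le
    rwa [hw] at this
  · exact measureReal_append_mul hQω (fun u => h2 _ (by rw [List.length_append]; omega)) u

/-- `(1 - η) p ≤ g ≤ y + |y - g| ≤ y exp (|y - g| / η)`, the last step by `1 + t ≤ exp t` and `η ≤
y`. It turns `L¹` closeness into a bound on a log ratio. -/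
theorem mul_exp_neg_le {p g y η : ℝ} (hη : 0 < η) (hη1 : η < 1)
    (hg : g = (1 - η) * p + η) (hy : η ≤ y) :
    p * Real.exp (Real.log (1 - η) - |y - g| / η) ≤ y := by
  have hy0 : 0 < y := hη.trans_le hy
  rw [Real.exp_sub, Real.exp_log (by linarith), mul_div_assoc', div_le_iff₀ (Real.exp_pos _)]
  have h1 : |y - g| / y ≤ |y - g| / η := by gcongr
  have h2 := Real.add_one_le_exp (|y - g| / η)
  have h3 : y * (|y - g| / y) = |y - g| := mul_div_cancel₀ _ hy0.ne'
  have h4 := neg_abs_le (y - g)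
  nlinarith [mul_le_mul_of_nonneg_left (show |y - g| / y + 1 ≤ Real.exp (|y - g| / η) by linarith)
    hy0.le]

theorem IsMarkovAPT.klSupport (hincr : P.StochasticallyIncreasing) (hac : P.AbsContCondition)
    {N : ℝ≥0} (hN : ∀ s i, i ≠ Fin.last m → P.F s i (Set.Ioc 0 (N : ℝ≥0∞)) ≠ 0)
    (havoid : P.ShrinkageAvoidable) {π : Measure (ProbabilityMeasure Ω)} (hπ : IsMarkovAPT P π)
    (P₀ : ProbabilityMeasure Ω) (hP₀ : (P₀ : Measure Ω) ≪ (P.Q₀ : Measure Ω)) {M : ℝ≥0}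
    (hM : ∀ᵐ x ∂(P.Q₀ : Measure Ω), (P₀ : Measure Ω).rnDeriv (P.Q₀ : Measure Ω) x ≤ M) :
    KLSupport π (P₀ : Measure Ω) := by
  intro c hc
  obtain ⟨hF, δ, -, k₀, hk₀⟩ := hac
  set Q₀ : Measure Ω := (P.Q₀ : Measure Ω) with hQ₀
  set ρ := (P₀ : Measure Ω).rnDeriv Q₀ with hρ
  have hρm : Measurable ρ := Measure.measurable_rnDeriv _ _
  have hPρ : Q₀.withDensity ρ = P₀ := Measure.withDensity_rnDeriv_eq _ _ hP₀
  set p : Ω → ℝ := fun x => (ρ x).toReal with hp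
  have hpi : Integrable p Q₀ := Measure.integrable_toReal_rnDeriv
  have hp1 : ∫ x, p x ∂Q₀ = 1 := by
    rw [Measure.integral_toReal_rnDeriv hP₀]; simp
  -- Mixing with weight `η` costs exactly `c / 4` on the log scale.
  set η : ℝ := 1 - Real.exp (-(c / 4)) with hη
  have hη0 : 0 < η := sub_pos.2 (Real.exp_lt_one_iff.2 (by linarith))
  have hη1 : η < 1 := sub_lt_self _ (Real.exp_pos _)
  have hlogη : Real.log (1 - η) = -(c / 4) := by rw [hη, sub_sub_cancel, Real.log_exp]
  set g : Ω → ℝ := fun x => (1 - η) * p x + η with hg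
  have hgi : Integrable g Q₀ := (hpi.const_mul _).add (integrable_const _)
  have hgm : Measurable g := (hρm.ennreal_toReal.const_mul _).add_const _
  have hgη : ∀ x, η ≤ g x := fun x => by
    have : 0 ≤ p x := ENNReal.toReal_nonneg
    simp only [hg]
    nlinarith
  have hg1 : ∫ x, g x ∂Q₀ ≤ 1 := by
    simp only [hg]
    rw [integral_add (hpi.const_mul _) (integrable_const _), integral_const_mul, hp1]
    simp
  have hPM : (P₀ : Measure Ω) ≤ M • Q₀ := by
    rw [← hPρ]
    refine (withDensity_mono hM).trans ?_
    rw [withDensity_const]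
    exact le_rfl
  -- Lévy's upward theorem in `L¹(Q₀)`; the bound `P₀ ≤ M • Q₀` transfers it to `P₀`.
  have hlim := hgi.tendsto_eLpNorm_condExp (ℱ := P.tree.filtration)
    (by rw [P.tree.iSup_filtration]; exact hgm.stronglyMeasurable)
  have hsmall : ∀ᶠ k in atTop, (M : ℝ≥0∞) * eLpNorm (Q₀[g | P.tree.filtration k] - g) 1 Q₀ <
      ENNReal.ofReal (η * (c / 4)) := by
    have := ENNReal.Tendsto.const_mul hlim (Or.inr (ENNReal.coe_ne_top (r := M)))
    rw [mul_zero] at this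
    exact this.eventually_lt_const (ENNReal.ofReal_pos.2 (by positivity))
  obtain ⟨k, hk, hkk, hk0⟩ :=
    (hsmall.and ((eventually_ge_atTop k₀).and (eventually_gt_atTop 0))).exists
  set ψ := Q₀[g | P.tree.filtration k] with hψ
  have hψm : Measurable ψ := stronglyMeasurable_condExp.measurable.mono (P.tree.filtration.le k)
    le_rfl
  have hψη : ∀ᵐ x ∂Q₀, η ≤ ψ x := by
    have := condExp_mono (m := P.tree.filtration k) (μ := Q₀) (integrable_const η) hgi
      (ae_of_all _ hgη)
    rwa [condExp_const (P.tree.filtration.le k)] at this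
  have hdi : Integrable (fun x => |ψ x - g x|) Q₀ := (integrable_condExp.sub hgi).abs
  have hdiP : Integrable (fun x => |ψ x - g x|) P₀ :=
    (hdi.smul_measure_nnreal (c := M)).mono_measure hPM
  have hdP : ∫ x, |ψ x - g x| ∂P₀ < η * (c / 4) := by
    refine (ENNReal.ofReal_lt_ofReal_iff (by positivity)).1 (lt_of_le_of_lt ?_ hk)
    rw [ofReal_integral_eq_lintegral_ofReal hdiP (ae_of_all _ fun _ => abs_nonneg _),
      eLpNorm_one_eq_lintegral_enorm]
    refine (lintegral_mono' hPM le_rfl).trans (le_of_eq ?_)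
    rw [lintegral_smul_measure, ENNReal.smul_def, smul_eq_mul]
    congr 1
    refine lintegral_congr fun x => ?_
    rw [Pi.sub_apply, ← ofReal_norm, Real.norm_eq_abs]
  -- Chosen after `k`, so that the `k` generations together cost another `c / 4`.
  set r : ℝ := Real.exp (-(c / 4) / k) with hr
  have hkpos : (0 : ℝ) < k := Nat.cast_pos.2 hk0
  have hr1 : r < 1 := Real.exp_lt_one_iff.2 (div_neg_of_neg_of_pos (by linarith) hkpos)
  have hrk : r ^ k = Real.exp (-(c / 4)) := by
    rw [hr, ← Real.exp_nat_mul]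
    congr 1
    field_simp
  have hmain := hπ.measure_ne_zero hincr hF (k := k)
    (fun s hs i hi => (pos_of_gt (hk₀ s (by omega) i hi)).ne') hk0 hN havoid hgi hη0 hgη hg1
    (Real.exp_pos _).le hr1
  -- The constant pays for mixing and for `r ^ k`; the last term has `P₀`-mean below `c / 4`, so the
  -- total stays below `3c / 4`.
  refine ⟨fun x => c / 2 + |ψ x - g x| / η, ?_, fun x => by positivity, ?_, ?_, ?_⟩
  · exact ((continuous_abs.measurable.comp (hψm.sub hgm)).div_const _).const_add _
  · exact (integrable_const _).add (hdiP.div_const _)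
  · rw [integral_add (integrable_const _) (hdiP.div_const _), integral_div η fun x => |ψ x - g x|]
    have : (∫ x, |ψ x - g x| ∂P₀) / η < c / 4 := by
      rw [div_lt_iff₀ hη0]; linarith
    simp only [integral_const, probReal_univ, one_smul]
    linarith
  · refine fun hzero => hmain (measure_mono_null ?_ hzero)
    intro Q hQ
    rw [Set.mem_ofPred_eq] at hQ ⊢
    refine le_trans ?_ hQ
    have hUm : Measurable fun x => ENNReal.ofReal (Real.exp (-(c / 2 + |ψ x - g x| / η))) :=
      (Real.measurable_exp.comp
        (((continuous_abs.measurable.comp (hψm.sub hgm)).div_const _).const_add _).neg).ennreal_ofReal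
    rw [← hPρ, ← withDensity_mul _ hρm hUm]
    refine withDensity_mono ?_
    filter_upwards [hM, hψη] with x hxM hx
    rw [Pi.mul_apply, ← ENNReal.ofReal_toReal (ne_top_of_le_ne_top ENNReal.coe_ne_top hxM),
      ← ENNReal.ofReal_mul ENNReal.toReal_nonneg]
    refine ENNReal.ofReal_le_ofReal ?_
    have hkey := mul_exp_neg_le hη0 hη1 (p := p x) (g := g x) rfl hx
    have hexp : Real.exp (-(c / 2 + |ψ x - g x| / η)) =
        r ^ k * Real.exp (Real.log (1 - η) - |ψ x - g x| / η) := by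
      rw [hrk, hlogη, ← Real.exp_add]
      congr 1
      ring
    rw [hexp]
    calc p x * (r ^ k * Real.exp (Real.log (1 - η) - |ψ x - g x| / η))
        = r ^ k * (p x * Real.exp (Real.log (1 - η) - |ψ x - g x| / η)) := by ring
      _ ≤ r ^ k * ψ x := by gcongr

theorem IsMarkovAPT.isProbabilityMeasure {π : Measure (ProbabilityMeasure Ω)}
    (hπ : IsMarkovAPT P π) : IsProbabilityMeasure π := by
  obtain ⟨S, _, Pr, C, ν, θ, Q, hPr, -, hQm, -, rfl⟩ := hπ
  exact Measure.isProbabilityMeasure_map hQm.aemeasurable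

end Support

theorem IsSampleSpace.pseudoMetrizable_and_separable {Ω : Type*} [TopologicalSpace Ω]
    [MeasurableSpace Ω] {μ : Measure Ω} (h : IsSampleSpace Ω μ) :
    TopologicalSpace.PseudoMetrizableSpace Ω ∧ TopologicalSpace.SeparableSpace Ω := by
  cases h with
  | finite hfin hdisc hμ => exact ⟨inferInstance, inferInstance⟩
  | rectangle p J hJ e hμ =>
    have := e.isInducing.secondCountableTopology
    exact ⟨e.isInducing.pseudoMetrizableSpace, inferInstance⟩

end MarkovAPT

theorem mainTheorem1 {Ω : Type*} [TopologicalSpace Ω] [MeasurableSpace Ω] [BorelSpace Ω]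
    (μ : Measure Ω) (hΩ : MarkovAPT.IsSampleSpace Ω μ) {m : ℕ} (P : MarkovAPT.Params Ω m)
    (hincr : P.StochasticallyIncreasing) (hac : P.AbsContCondition)
    (hsupp : P.LargeSupportCondition μ) (havoid : P.ShrinkageAvoidable)
    (π : Measure (ProbabilityMeasure Ω)) (hπ : MarkovAPT.IsMarkovAPT P π)
    (Post : (n : ℕ) → Kernel (Fin n → Ω) (ProbabilityMeasure Ω))
    (hPost : ∀ n, MarkovAPT.IsPosterior π (Post n))
    (P₀ : ProbabilityMeasure Ω) (hP₀ : (P₀ : Measure Ω) ≪ (P.Q₀ : Measure Ω))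
    (hbdd : ∃ M : ℝ≥0, ∀ᵐ x ∂(P.Q₀ : Measure Ω),
      (P₀ : Measure Ω).rnDeriv (P.Q₀ : Measure Ω) x ≤ M) :
    ∀ᵐ x ∂(Measure.infinitePi fun _ : ℕ => (P₀ : Measure Ω)),
      ∀ (K : ℕ) (f : Fin K → BoundedContinuousFunction Ω ℝ) (ε : Fin K → ℝ), (∀ i, 0 < ε i) →
        Tendsto (fun n : ℕ => Post n (fun i : Fin n => x i) (MarkovAPT.weakNhd P₀ f ε))
          atTop (𝓝 1) := by
  obtain ⟨_, _⟩ := hΩ.pseudoMetrizable_and_separable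
  have := hπ.isProbabilityMeasure
  obtain ⟨M, hM⟩ := hbdd
  obtain ⟨ε, -, N, -, hN⟩ := hsupp.prec_mass
  have hKL := hπ.klSupport hincr hac (fun s i hi => (pos_of_gt (hN s i hi)).ne') havoid P₀ hP₀ hM
  filter_upwards [MarkovAPT.posterior_consistent_of_klSupport hPost P₀ hKL] with x hx K f ε hε
  exact hx _ (MarkovAPT.weakNhd_mem_nhds P₀ f hε)
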